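/- Let $k$ be a field and let $(\mathcal B,\mathbb E,\mathfrak s)$ be an extriangulated category (in the sense of Nakaoka--Palu) whose underlying additive category is $k$-linear, Hom-finite and Krull--Schmidt, and which has enough projectives and enough injectives. Let $\mathcal I$ be the full subcategory of injective objects. Let $\overline{\mathcal B}=\mathcal B/\mathcal I$ be the category with the same objects as $\mathcal B$ and with morphisms taken modulo those that factor through an object of $\mathcal I$, and write $\overline f$ for the class of a morphism $f$. Let $\mathcal T$ be a full subcategory of $\mathcal B$, closed under isomorphisms, direct sums and direct summands. Let $\Sigma\mathcal T$ be the class of objects $Y$ that admit an $\mathbb E$-triangle $T\to I\to Y\dashrightarrow$ with $T\in\mathcal T$ and $I\in\mathcal I$, and let $\overline{\Sigma\mathcal T}$ be the corresponding full subcategory of $\overline{\mathcal B}$. Suppose that $\mathcal T$ is covariantly finite (every object of $\mathcal B$ has a left $\mathcal T$-approximation), that $\mathcal I\subset\mathcal T$, and that $\mathbb E(\mathcal I,\mathcal T)=0$. Then for every object $A$ of $\mathcal B$ the functor $\operatorname{Hom}_{\overline{\mathcal B}}(A,-)|_{\overline{\Sigma\mathcal T}}$ is finitely presented, that is, a cokernel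 of a morphism between representable functors $\overline{\Sigma\mathcal T}\to\mathsf{Ab}$. Moreover, the contravariant functor $$\operatorname{Hom}_{\overline{\mathcal B}}(-,\Sigma\mathcal T)\colon\ \mathcal B^{\mathrm{op}}\to\{\text{finitely presented functors }\overline{\Sigma\mathcal T}\to\mathsf{Ab}\},\qquad A\mapsto \operatorname{Hom}_{\overline{\mathcal B}}(A,-)|_{\overline{\Sigma\mathcal T}},$$ is full and dense if and only if both conditions (a$^{\mathrm{op}}$) and (b$^{\mathrm{op}}$) below hold. Both refer to commutative diagrams $$\begin{array}{ccccc} T_2&\to&T_1&\xrightarrow{\ h\ }&A\\ \|&&\downarrow&&\downarrow\\ T_2&\to&I&\to&S_2\\ &&\downarrow&&\downarrow{\scriptstyle g}\\ &&S_1&=&S_1 \end{array}\qquad(\ast)$$ in $\mathcal B$ with $T_1,T_2\in\mathcal T$ and $I\in\mathcal I$, in which the two full rows $T_2\to T_1\to A$ and $T_2\to I\to S_2$ and the two full columns $T_1\to I\to S_1$ and $A\to S_2\to S_1$ are $\mathbb E$-triangles, and the vertical maps between the rows and the horizontal maps between the columns are morphisms of $\mathbb E$-triangles. (a$^{\mathrm{op}}$)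 In every diagram $(\ast)$, if $\overline g\neq 0$ and $\overline g$ is left minimal (every endomorphism $\alpha$ of $S_1$ in $\overline{\mathcal B}$ with $\alpha\,\overline g=\overline g$ is an isomorphism), then $\operatorname{Hom}_{\overline{\mathcal B}}(\overline h,\Sigma\mathcal T)=0$. (b$^{\mathrm{op}}$) Every indecomposable object $A$ with $\operatorname{Hom}_{\overline{\mathcal B}}(A,\Sigma\mathcal T)\neq0$ occurs in some diagram $(\ast)$ with $\operatorname{Hom}_{\overline{\mathcal B}}(\overline h,\Sigma\mathcal T)=0$. -/

import Mathlib

open CategoryTheory CategoryTheory.Limits Opposite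

universe w v u

noncomputable section

namespace Extriang

instance hasBinaryBiproducts_of_hasFiniteBiproducts {C : Type u} [Category.{v} C]
    [HasZeroMorphisms C] [HasFiniteBiproducts C] : HasBinaryBiproducts C :=
  hasBinaryBiproducts_of_finite_biproducts C

/-! ### Extriangulated categories (Nakaoka--Palu) -/

section Sequences

variable {C : Type u} [Category.{v} C]

/-- Sequences `X ⟶ Y ⟶ Z` with fixed ends `X` and `Z`. -/
structure Seq (X Z : C) where
  mid : C
  inf : X ⟶ mid
  defl : mid ⟶ Z

/-- Two sequences with the same ends are equivalent if an isomorphism of the middle terms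
commutes with the morphisms of the sequences. -/
def Seq.Equivalent {X Z : C} (p q : Seq X Z) : Prop :=
  ∃ b : p.mid ≅ q.mid, p.inf ≫ b.hom = q.inf ∧ b.hom ≫ q.defl = p.defl

instance seqSetoid (X Z : C) : Setoid (Seq X Z) where
  r := Seq.Equivalent
  iseqv :=
    { refl := fun p => ⟨Iso.refl _, by simp, by simp⟩
      symm := by
        rintro p q ⟨b, h₁, h₂⟩
        exact ⟨b.symm, by simp [← h₁], by simp [← h₂]⟩
      trans := by
        rintro p q r ⟨b, h₁, h₂⟩ ⟨c, h₃, h₄⟩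
        exact ⟨b ≪≫ c, by simp [← h₃, ← h₁], by simp [h₄, h₂]⟩ }

/-- Equivalence classes `[X ⟶ Y ⟶ Z]`. -/
abbrev SeqClass (X Z : C) := Quotient (seqSetoid X Z)

/-- The equivalence class of `x : X ⟶ Y`, `y : Y ⟶ Z`. -/
def seqClass {X Y Z : C} (x : X ⟶ Y) (y : Y ⟶ Z) : SeqClass X Z :=
  Quotient.mk _ ⟨Y, x, y⟩

end Sequences

section Bifunctor

variable {C : Type u} [Category.{v} C] (E : Cᵒᵖ ⥤ C ⥤ AddCommGrpCat.{w})

/-- The group `E(Z, X)` of extensions of `Z` by `X`. -/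
abbrev Ext (Z X : C) : Type w := (E.obj (op Z)).obj X

variable {E}

/-- `a_* δ`. -/
def push {X X' Z : C} (a : X ⟶ X') (δ : Ext E Z X) : Ext E Z X' :=
  ((E.obj (op Z)).map a).hom δ

/-- `c^* δ`. -/
def pull {X Z Z' : C} (c : Z' ⟶ Z) (δ : Ext E Z X) : Ext E Z' X :=
  ((E.map c.op).app X).hom δ

variable [Preadditive C] [HasFiniteBiproducts C]

/-- `δ ⊕ δ'`, the element of `E(Z ⊕ Z', X ⊕ X')` with components `(δ, 0, 0, δ')`. -/
def extSum {X X' Z Z' : C} (δ : Ext E Z X) (δ' : Ext E Z' X') : Ext E (Z ⊞ Z') (X ⊞ X') :=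
  pull biprod.fst (push biprod.inl δ) + pull biprod.snd (push biprod.inr δ')

end Bifunctor

/-- The structure of an extriangulated category on an additive category `C`. -/
structure ExtriangulatedStructure (C : Type u) [Category.{v} C] [Preadditive C]
    [HasFiniteBiproducts C] where
  /-- The bifunctor `E : Cᵒᵖ × C ⥤ Ab`, additive in each variable (ET1). -/
  E : Cᵒᵖ ⥤ C ⥤ AddCommGrpCat.{w}
  additive_left : E.Additive
  additive_right : ∀ Z : Cᵒᵖ, (E.obj Z).Additive
  /-- The correspondence sending an extension to an equivalence class of sequences. -/
  s : ∀ {Z X : C}, Ext E Z X → SeqClass X Z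
  /-- Morphisms of extensions are realized by morphisms of sequences. -/
  realization : ∀ {X Y Z X' Y' Z' : C} {x : X ⟶ Y} {y : Y ⟶ Z} {x' : X' ⟶ Y'} {y' : Y' ⟶ Z'}
    {δ : Ext E Z X} {δ' : Ext E Z' X'}, s δ = seqClass x y → s δ' = seqClass x' y' →
    ∀ (a : X ⟶ X') (c : Z ⟶ Z'), push a δ = pull c δ' →
      ∃ b : Y ⟶ Y', x ≫ b = a ≫ x' ∧ y ≫ c = b ≫ y'
  /-- The split extension is realized by the split sequence. -/
  s_zero : ∀ Z X : C, s (0 : Ext E Z X) = seqClass (biprod.inl : X ⟶ X ⊞ Z) biprod.snd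
  /-- The realization is compatible with direct sums. -/
  s_sum : ∀ {X Y Z X' Y' Z' : C} {x : X ⟶ Y} {y : Y ⟶ Z} {x' : X' ⟶ Y'} {y' : Y' ⟶ Z'}
    {δ : Ext E Z X} {δ' : Ext E Z' X'}, s δ = seqClass x y → s δ' = seqClass x' y' →
    s (extSum δ δ') = seqClass (biprod.map x x') (biprod.map y y')
  et3 : ∀ {X Y Z X' Y' Z' : C} {x : X ⟶ Y} {y : Y ⟶ Z} {x' : X' ⟶ Y'} {y' : Y' ⟶ Z'}
    {δ : Ext E Z X} {δ' : Ext E Z' X'}, s δ = seqClass x y → s δ' = seqClass x' y' →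
    ∀ (a : X ⟶ X') (b : Y ⟶ Y'), x ≫ b = a ≫ x' →
      ∃ c : Z ⟶ Z', y ≫ c = b ≫ y' ∧ push a δ = pull c δ'
  et3_op : ∀ {X Y Z X' Y' Z' : C} {x : X ⟶ Y} {y : Y ⟶ Z} {x' : X' ⟶ Y'} {y' : Y' ⟶ Z'}
    {δ : Ext E Z X} {δ' : Ext E Z' X'}, s δ = seqClass x y → s δ' = seqClass x' y' →
    ∀ (b : Y ⟶ Y') (c : Z ⟶ Z'), y ≫ c = b ≫ y' →
      ∃ a : X ⟶ X', x ≫ b = a ≫ x' ∧ push a δ = pull c δ'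
  et4 : ∀ {X Y D W F : C} {f : X ⟶ Y} {f' : Y ⟶ D} {g : Y ⟶ W} {g' : W ⟶ F}
    {δ : Ext E D X} {δ' : Ext E F Y}, s δ = seqClass f f' → s δ' = seqClass g g' →
    ∃ (G : C) (d : D ⟶ G) (e : G ⟶ F) (h' : W ⟶ G) (δ'' : Ext E G X),
      s δ'' = seqClass (f ≫ g) h' ∧ f' ≫ d = g ≫ h' ∧ h' ≫ e = g' ∧
      s (push f' δ') = seqClass d e ∧ pull d δ'' = δ ∧ push f δ'' = pull e δ'
  et4_op : ∀ {X Y D W F : C} {f' : D ⟶ Y} {f : Y ⟶ X} {g' : F ⟶ W} {g : W ⟶ Y}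
    {δ : Ext E X D} {δ' : Ext E Y F}, s δ = seqClass f' f → s δ' = seqClass g' g →
    ∃ (G : C) (e : F ⟶ G) (d : G ⟶ D) (h' : G ⟶ W) (δ'' : Ext E X G),
      s δ'' = seqClass h' (g ≫ f) ∧ d ≫ f' = h' ≫ g ∧ e ≫ h' = g' ∧
      s (pull f' δ') = seqClass e d ∧ push d δ'' = δ ∧ pull f δ'' = push e δ'

/-- Every object is a finite direct sum of objects with local endomorphism rings. -/
def IsKrullSchmidt (C : Type u) [Category.{v} C] [Preadditive C] [HasFiniteBiproducts C] : Prop :=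
  ∀ X : C, ∃ (n : ℕ) (Y : Fin n → C), (∀ i, IsLocalRing (End (Y i))) ∧ Nonempty (X ≅ ⨁ Y)

/-- All morphism spaces are finite dimensional over `k`. -/
def IsHomFinite (k : Type*) [Field k] (C : Type u) [Category.{v} C] [Preadditive C]
    [Linear k C] : Prop :=
  ∀ X Y : C, Module.Finite k (X ⟶ Y)

/-- A morphism `g : X ⟶ Y` is left minimal if every `α : Y ⟶ Y` with `α ∘ g = g` is an
isomorphism. -/
def IsLeftMinimal {D : Type*} [Category* D] {X Y : D} (g : X ⟶ Y) : Prop :=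
  ∀ α : Y ⟶ Y, g ≫ α = g → IsIso α

section Subcategories

variable {C : Type u} [Category.{v} C] [Preadditive C] [HasFiniteBiproducts C]

/-- A full subcategory which is closed under isomorphisms, direct sums and direct summands. -/
structure IsAdditiveSubcategory (T : ObjectProperty C) : Prop where
  iso : ∀ {X Y : C}, (X ≅ Y) → T X → T Y
  sum : ∀ {X Y : C}, T X → T Y → T (X ⊞ Y)
  summand : ∀ {X Y : C}, T (X ⊞ Y) → T X

/-- Every object `X` has a left `T`-approximation. -/
def CovariantlyFinite (T : ObjectProperty C) : Prop :=
  ∀ X : C, ∃ (T₀ : C) (f : X ⟶ T₀), T T₀ ∧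
    ∀ (T₁ : C) (g : X ⟶ T₁), T T₁ → ∃ t : T₀ ⟶ T₁, f ≫ t = g

end Subcategories

variable {C : Type u} [Category.{v} C] [Preadditive C] [HasFiniteBiproducts C]

namespace ExtriangulatedStructure

variable (S : ExtriangulatedStructure.{w} C)

/-- `X ⟶ Y ⟶ Z` together with `δ` is an `E`-triangle. -/
def IsTriangle {X Y Z : C} (x : X ⟶ Y) (y : Y ⟶ Z) (δ : Ext S.E Z X) : Prop :=
  S.s δ = seqClass x y

/-- The projective objects. -/
def projectives : ObjectProperty C := fun P =>
  ∀ {X Y Z : C} (x : X ⟶ Y) (y : Y ⟶ Z) (δ : Ext S.E Z X), S.IsTriangle x y δ →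
    ∀ c : P ⟶ Z, ∃ b : P ⟶ Y, b ≫ y = c

/-- The injective objects. -/
def injectives : ObjectProperty C := fun I =>
  ∀ {X Y Z : C} (x : X ⟶ Y) (y : Y ⟶ Z) (δ : Ext S.E Z X), S.IsTriangle x y δ →
    ∀ a : X ⟶ I, ∃ b : Y ⟶ I, x ≫ b = a

def EnoughProjectives : Prop :=
  ∀ Z : C, ∃ (X P : C) (x : X ⟶ P) (y : P ⟶ Z) (δ : Ext S.E Z X),
    S.projectives P ∧ S.IsTriangle x y δ

def EnoughInjectives : Prop :=
  ∀ X : C, ∃ (I Z : C) (x : X ⟶ I) (y : I ⟶ Z) (δ : Ext S.E Z X),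
    S.injectives I ∧ S.IsTriangle x y δ

/-- `Cone(B', B'')`: the objects `Y` admitting an `E`-triangle `B' ⟶ B'' ⟶ Y`. -/
def cone (B' B'' : ObjectProperty C) : ObjectProperty C := fun Y =>
  ∃ (X' X'' : C) (x : X' ⟶ X'') (y : X'' ⟶ Y) (δ : Ext S.E Y X'),
    B' X' ∧ B'' X'' ∧ S.IsTriangle x y δ

/-- `Σ T = Cone(T, I)`. -/
def susp (T : ObjectProperty C) : ObjectProperty C := S.cone T S.injectives

lemma injectives_of_isZero {I : C} (hI : IsZero I) : S.injectives I :=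
  fun _ _ _ _ _ => ⟨0, hI.eq_of_tgt _ _⟩

lemma injectives_biprod {I J : C} (hI : S.injectives I) (hJ : S.injectives J) :
    S.injectives (I ⊞ J) := by
  intro X Y Z x y δ h a
  obtain ⟨b, hb⟩ := hI x y δ h (a ≫ biprod.fst)
  obtain ⟨c, hc⟩ := hJ x y δ h (a ≫ biprod.snd)
  exact ⟨biprod.lift b c, by ext <;> simp [hb, hc]⟩

/-! ### The quotient of `C` by the injective objects -/

/-- `f` factors through an injective object. -/
def FactorsInj {X Y : C} (f : X ⟶ Y) : Prop :=
  ∃ (I : C) (p : X ⟶ I) (q : I ⟶ Y), S.injectives I ∧ p ≫ q = f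

/-- Two morphisms are identified if their difference factors through an injective object. -/
def injRel : HomRel C := fun _ _ f g => S.FactorsInj (f - g)

lemma factorsInj_zero (X Y : C) : S.FactorsInj (0 : X ⟶ Y) :=
  ⟨⨁ (fun i : Fin 0 => i.elim0), 0, 0, S.injectives_of_isZero (by
    rw [IsZero.iff_id_eq_zero]
    ext i
    exact i.elim0), by simp⟩

variable {S} in
lemma FactorsInj.add {X Y : C} {f g : X ⟶ Y} (hf : S.FactorsInj f) (hg : S.FactorsInj g) :
    S.FactorsInj (f + g) := by
  obtain ⟨I, p, q, hI, rfl⟩ := hf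
  obtain ⟨J, p', q', hJ, rfl⟩ := hg
  exact ⟨I ⊞ J, biprod.lift p p', biprod.desc q q', S.injectives_biprod hI hJ, by simp⟩

variable {S} in
lemma FactorsInj.neg {X Y : C} {f : X ⟶ Y} (hf : S.FactorsInj f) : S.FactorsInj (-f) := by
  obtain ⟨I, p, q, hI, rfl⟩ := hf
  exact ⟨I, -p, q, hI, by simp⟩

instance : Congruence S.injRel where
  equivalence :=
    { refl := fun f => by simpa [injRel] using S.factorsInj_zero _ _
      symm := fun {f g} h => by simpa [injRel] using FactorsInj.neg h
      trans := fun {f g e} h h' => by simpa [injRel] using FactorsInj.add h h' }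
  comp_left := by
    rintro X Y Z f g g' ⟨I, p, q, hI, h⟩
    exact ⟨I, f ≫ p, q, hI, by simp [h]⟩
  comp_right := by
    rintro X Y Z f f' g ⟨I, p, q, hI, h⟩
    exact ⟨I, p, q ≫ g, hI, by simp [← Category.assoc, h]⟩

lemma injRel_add ⦃X Y : C⦄ (f₁ f₂ g₁ g₂ : X ⟶ Y) (hf : S.injRel f₁ f₂) (hg : S.injRel g₁ g₂) :
    S.injRel (f₁ + g₁) (f₂ + g₂) := by
  have h := FactorsInj.add hf hg
  rwa [sub_add_sub_comm] at h

/-- The category `C / I`, with the objects of `C` and with morphisms taken modulo those that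
factor through an injective object. -/
abbrev Bar := CategoryTheory.Quotient S.injRel

instance : Preadditive S.Bar := Quotient.preadditive S.injRel S.injRel_add

/-- The projection `C ⥤ C / I`. -/
abbrev bar : C ⥤ S.Bar := Quotient.functor S.injRel

/-- `Σ T`, viewed as a full subcategory of `C / I`. -/
abbrev SuspBar (T : ObjectProperty C) :=
  ObjectProperty.FullSubcategory (fun Y : S.Bar => S.susp T Y.as)

/-- The functor `Hom_{C/I}(-, Σ T)`, which sends an object `X` of `C` to the functor
`Hom_{C/I}(X, -)` on `Σ T / I`. -/
def homSusp (T : ObjectProperty C) : Cᵒᵖ ⥤ S.SuspBar T ⥤ AddCommGrpCat.{v} :=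
  S.bar.op ⋙ preadditiveCoyoneda ⋙
    (Functor.whiskeringLeft _ _ _).obj (ObjectProperty.ι (fun Y : S.Bar => S.susp T Y.as))

end ExtriangulatedStructure

/-- Finitely presented (covariant) functors: the cokernels of morphisms between representable
functors. -/
def finPres (D : Type*) [Category.{v} D] [Preadditive D] :
    ObjectProperty (D ⥤ AddCommGrpCat.{v}) := fun F =>
  ∃ (S₂ S₁ : D) (g : S₂ ⟶ S₁), Nonempty (F ≅ cokernel (preadditiveCoyoneda.map g.op))

/-- The category of finitely presented functors on `D`. -/
abbrev FinPresMod (D : Type*) [Category.{v} D] [Preadditive D] := (finPres D).FullSubcategory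

namespace ExtriangulatedStructure

variable (S : ExtriangulatedStructure.{w} C)

/-- The commutative diagram
```
T₂ --a--> T₁ --h--> A
||        |i        |r
T₂ --b--> I --c---> S₂
          |j        |g
          S₁ ====== S₁
```
whose rows and columns are `E`-triangles and in which the two rows, and the two columns, are
related by the displayed morphisms of `E`-triangles. -/
def IsDiagram {T₂ T₁ A I S₂ S₁ : C} (a : T₂ ⟶ T₁) (h : T₁ ⟶ A) (b : T₂ ⟶ I) (c : I ⟶ S₂)
    (i : T₁ ⟶ I) (j : I ⟶ S₁) (r : A ⟶ S₂) (g : S₂ ⟶ S₁) : Prop :=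
  a ≫ i = b ∧ h ≫ r = i ≫ c ∧ c ≫ g = j ∧
  ∃ (δ₁ : Ext S.E A T₂) (δ₂ : Ext S.E S₂ T₂) (ε₁ : Ext S.E S₁ T₁) (ε₂ : Ext S.E S₁ A),
    S.IsTriangle a h δ₁ ∧ S.IsTriangle b c δ₂ ∧ S.IsTriangle i j ε₁ ∧ S.IsTriangle r g ε₂ ∧
    δ₁ = pull r δ₂ ∧ push h ε₁ = ε₂

/-- In every such diagram with `T₁, T₂` in `T` and `I` injective, if the class of `g` in `C / I` is
nonzero and left minimal, then `Hom_{C/I}(h, Σ T) = 0`. -/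
def ConditionA (T : ObjectProperty C) : Prop :=
  ∀ {T₂ T₁ A I S₂ S₁ : C} (a : T₂ ⟶ T₁) (h : T₁ ⟶ A) (b : T₂ ⟶ I) (c : I ⟶ S₂)
    (i : T₁ ⟶ I) (j : I ⟶ S₁) (r : A ⟶ S₂) (g : S₂ ⟶ S₁),
    S.IsDiagram a h b c i j r g → T T₁ → T T₂ → S.injectives I →
    S.bar.map g ≠ 0 → IsLeftMinimal (S.bar.map g) → (S.homSusp T).map h.op = 0

/-- Every indecomposable `A` with `Hom_{C/I}(A, Σ T) ≠ 0` admits such a diagram with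
`T₁, T₂` in `T`, `I` injective and `Hom_{C/I}(h, Σ T) = 0`. -/
def ConditionB (T : ObjectProperty C) : Prop :=
  ∀ A : C, Indecomposable A → ¬ IsZero ((S.homSusp T).obj (op A)) →
    ∃ (T₂ T₁ I S₂ S₁ : C) (a : T₂ ⟶ T₁) (h : T₁ ⟶ A) (b : T₂ ⟶ I) (c : I ⟶ S₂)
      (i : T₁ ⟶ I) (j : I ⟶ S₁) (r : A ⟶ S₂) (g : S₂ ⟶ S₁),
      S.IsDiagram a h b c i j r g ∧ T T₁ ∧ T T₂ ∧ S.injectives I ∧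
      (S.homSusp T).map h.op = 0

end ExtriangulatedStructure

end Extriang

end

/-! ### Exactness properties of `E`-triangles -/

namespace Extriang

/-! Let Y = ΣX come from a triangle X → I → Y with class δ. Since E(-, I) = 0 and E(𝓘, 𝓣) = 0,
pulling δ back identifies Hom(A, Y) modulo injectives with E(A, X) (`IsSusp.exists_pull`,
`IsSusp.pull_eq_zero_iff`). Dually, pushing δ forward shows that morphisms in Σ𝓣 are induced by
morphisms in 𝓣. A projective cover sequence K → P → A and two left 𝓣-approximations then present
Hom(A, -).

In a diagram (∗), A → S₂ → S₁ always makes r a weak kernel of g and g a weak cokernel of r modulo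
injectives. The condition Hom(h, Σ𝓣) = 0 supplies what is missing: every map from A to Σ𝓣 factors
through r, so g presents Hom(A, -) (`IsDiagram.presents`). Natural transformations out of Hom(A, -)
then come from morphisms, because the image of r lifts along the weak kernel. Thus (b) gives
fullness, one indecomposable summand at a time.

For density from (a), any presentation is shrunk to a left minimal one by Fitting's lemma
(`exists_leftMinimal_presentation`), and its morphism is placed in a diagram
(`exists_isDiagram_of_hom`); condition (a) then applies, unless the morphism is zero, where the
functor is visibly representable.

Conversely, if the functor is full and dense, the cokernel of Hom(g, -) is some Hom(X, -), and maps
back and forth between A and X induce an endomorphism of S₁ fixing g. Left minimality inverts it,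
which forces Hom(h, Σ𝓣) = 0; this is (a). For (b), density under (a) gives A' with a good diagram
and Hom(A', -) ≅ Hom(A, -). Fullness makes A a summand of A' with a complement invisible to Σ𝓣, and
the diagram restricts to A. -/

lemma seqClass_eq_iff {C : Type u} [Category.{v} C] {X Y Y' Z : C} {x : X ⟶ Y}
    {y : Y ⟶ Z} {x' : X ⟶ Y'} {y' : Y' ⟶ Z} :
    seqClass x y = seqClass x' y' ↔ ∃ b : Y ≅ Y', x ≫ b.hom = x' ∧ b.hom ≫ y' = y :=
  Quotient.eq (r := seqSetoid X Z)

section Bifunctor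

variable {C : Type u} [Category.{v} C] {E : Cᵒᵖ ⥤ C ⥤ AddCommGrpCat.{w}}

@[simp] lemma push_id {X Z : C} (δ : Ext E Z X) : push (𝟙 X) δ = δ := by simp [push]

@[simp] lemma pull_id {X Z : C} (δ : Ext E Z X) : pull (𝟙 Z) δ = δ := by simp [pull]

lemma push_comp {X X' X'' Z : C} (a : X ⟶ X') (b : X' ⟶ X'') (δ : Ext E Z X) :
    push (a ≫ b) δ = push b (push a δ) := by simp [push]

lemma pull_comp {X Z Z' Z'' : C} (c : Z'' ⟶ Z') (d : Z' ⟶ Z) (δ : Ext E Z X) :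
    pull (c ≫ d) δ = pull c (pull d δ) := by simp [pull]

lemma push_pull {X X' Z Z' : C} (a : X ⟶ X') (c : Z' ⟶ Z) (δ : Ext E Z X) :
    push a (pull c δ) = pull c (push a δ) := by
  have := (E.map c.op).naturality a
  exact (congrArg (fun f => f.hom δ) this).symm

@[simp] lemma push_zero_right {X X' Z : C} (a : X ⟶ X') : push a (0 : Ext E Z X) = 0 :=
  map_zero _

@[simp] lemma pull_zero_right {X Z Z' : C} (c : Z' ⟶ Z) : pull c (0 : Ext E Z X) = 0 :=
  map_zero _

end Bifunctor

namespace ExtriangulatedStructure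

variable {C : Type u} [Category.{v} C] [Preadditive C] [HasFiniteBiproducts C]
variable (S : ExtriangulatedStructure.{w} C)

lemma push_add {X X' Z : C} (a b : X ⟶ X') (δ : Ext S.E Z X) :
    push (a + b) δ = push a δ + push b δ := by
  have := S.additive_right (op Z)
  simp [push, Functor.map_add]

lemma pull_add {X Z Z' : C} (a b : Z' ⟶ Z) (δ : Ext S.E Z X) :
    pull (a + b) δ = pull a δ + pull b δ := by
  have := S.additive_left
  simp [pull, Functor.map_add]

@[simp] lemma push_zero {X X' Z : C} (δ : Ext S.E Z X) : push (0 : X ⟶ X') δ = 0 := by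
  simpa using S.push_add (0 : X ⟶ X') 0 δ

@[simp] lemma pull_zero {X Z Z' : C} (δ : Ext S.E Z X) : pull (0 : Z' ⟶ Z) δ = 0 := by
  simpa using S.pull_add (0 : Z' ⟶ Z) 0 δ

lemma push_sub {X X' Z : C} (a b : X ⟶ X') (δ : Ext S.E Z X) :
    push (a - b) δ = push a δ - push b δ := by
  rw [eq_sub_iff_add_eq, ← push_add, sub_add_cancel]

lemma pull_sub {X Z Z' : C} (a b : Z' ⟶ Z) (δ : Ext S.E Z X) :
    pull (a - b) δ = pull a δ - pull b δ := by
  rw [eq_sub_iff_add_eq, ← pull_add, sub_add_cancel]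

lemma exists_isTriangle {X Z : C} (δ : Ext S.E Z X) :
    ∃ (Y : C) (x : X ⟶ Y) (y : Y ⟶ Z), S.IsTriangle x y δ := by
  obtain ⟨⟨Y, x, y⟩, h⟩ := Quotient.exists_rep (S.s δ)
  exact ⟨Y, x, y, h.symm⟩

variable {S}

/-- Triangles are closed under isomorphisms of the middle term. -/
lemma IsTriangle.of_iso {X Y Y' Z : C} {x : X ⟶ Y} {y : Y ⟶ Z} {δ : Ext S.E Z X}
    (h : S.IsTriangle x y δ) (b : Y ≅ Y') {x' : X ⟶ Y'} {y' : Y' ⟶ Z}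
    (hx : x ≫ b.hom = x') (hy : b.hom ≫ y' = y) : S.IsTriangle x' y' δ :=
  Eq.trans h (seqClass_eq_iff.2 ⟨b, hx, hy⟩)

lemma isTriangle_split (Z X : C) :
    S.IsTriangle (biprod.inl : X ⟶ X ⊞ Z) biprod.snd (0 : Ext S.E Z X) :=
  S.s_zero Z X

lemma isTriangle_id_zero (X : C) {O : C} (hO : IsZero O) :
    S.IsTriangle (𝟙 X) (0 : X ⟶ O) (0 : Ext S.E O X) :=
  (isTriangle_split O X).of_iso
    ⟨biprod.fst, biprod.inl, by ext; exacts [by simp, by simp, hO.eq_of_src _ _, hO.eq_of_src _ _],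
      by simp⟩ (by simp) (hO.eq_of_tgt _ _)

lemma isTriangle_zero_id (Z : C) {O : C} (hO : IsZero O) :
    S.IsTriangle (0 : O ⟶ Z) (𝟙 Z) (0 : Ext S.E Z O) :=
  (isTriangle_split Z O).of_iso
    ⟨biprod.snd, biprod.inr, by ext; exacts [hO.eq_of_src _ _, hO.eq_of_src _ _, by simp, by simp],
      by simp⟩ (by simp) (by simp)

section

variable {X Y Z : C} {x : X ⟶ Y} {y : Y ⟶ Z} {δ : Ext S.E Z X}

lemma IsTriangle.comp_zero (h : S.IsTriangle x y δ) : x ≫ y = 0 := by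
  obtain ⟨c, hc, -⟩ := S.et3 (isTriangle_id_zero (S := S) X (isZero_zero C)) h (𝟙 X) x (by simp)
  simpa using hc.symm

lemma IsTriangle.push_inf (h : S.IsTriangle x y δ) : push x δ = 0 := by
  obtain ⟨c, -, hc⟩ := S.et3 h (isTriangle_id_zero (S := S) Y (isZero_zero C)) x (𝟙 Y) (by simp)
  simpa using hc

lemma IsTriangle.pull_defl (h : S.IsTriangle x y δ) : pull y δ = 0 := by
  obtain ⟨c, -, hc⟩ := S.et3_op (isTriangle_zero_id (S := S) Y (isZero_zero C)) h (𝟙 Y) y (by simp)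
  simpa using hc.symm

/-- When f^*δ = 0, the pair (𝟙, f) is a morphism from the split extension; its realization,
restricted to the summand W, lifts f. -/
lemma IsTriangle.pull_eq_zero_iff (h : S.IsTriangle x y δ) {W : C} (f : W ⟶ Z) :
    pull f δ = 0 ↔ ∃ f' : W ⟶ Y, f' ≫ y = f := by
  constructor
  · intro hf
    obtain ⟨b, -, hb⟩ := S.realization (isTriangle_split W X) h (𝟙 X) f (by simp [hf])
    exact ⟨biprod.inr ≫ b, by simp [← hb]⟩
  · rintro ⟨f', rfl⟩
    simp [pull_comp, h.pull_defl]

lemma IsTriangle.push_eq_zero_iff (h : S.IsTriangle x y δ) {W : C} (f : X ⟶ W) :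
    push f δ = 0 ↔ ∃ f' : Y ⟶ W, x ≫ f' = f := by
  constructor
  · intro hf
    obtain ⟨b, hb, -⟩ := S.realization h (isTriangle_split Z W) f (𝟙 Z) (by simp [hf])
    exact ⟨b ≫ biprod.fst, by simp [reassoc_of% hb]⟩
  · rintro ⟨f', rfl⟩
    simp [push_comp, h.push_inf]

lemma IsTriangle.exists_lift (h : S.IsTriangle x y δ) {W : C} (f : W ⟶ Y) (hf : f ≫ y = 0) :
    ∃ f' : W ⟶ X, f' ≫ x = f := by
  obtain ⟨a, ha, -⟩ := S.et3_op (isTriangle_id_zero (S := S) W (isZero_zero C)) h f 0 (by simp [hf])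
  exact ⟨a, by simpa using ha.symm⟩

lemma IsTriangle.exists_desc (h : S.IsTriangle x y δ) {W : C} (f : Y ⟶ W) (hf : x ≫ f = 0) :
    ∃ f' : Z ⟶ W, y ≫ f' = f := by
  obtain ⟨c, hc, -⟩ := S.et3 h (isTriangle_zero_id (S := S) W (isZero_zero C)) 0 f (by simp [hf])
  exact ⟨c, by simpa using hc⟩

/-- Exactness of `Hom(X, X') ⟶ E(Z, X') ⟶ E(Y, X')`. -/
lemma IsTriangle.exists_push (h : S.IsTriangle x y δ) {X' : C} (θ : Ext S.E Z X')
    (hθ : pull y θ = 0) : ∃ t : X ⟶ X', push t δ = θ := by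
  obtain ⟨M, m, n, hM⟩ := S.exists_isTriangle θ
  obtain ⟨f, hf⟩ := (hM.pull_eq_zero_iff y).1 hθ
  obtain ⟨a, -, ha⟩ := S.et3_op h hM f (𝟙 Z) (by simp [hf])
  exact ⟨a, by simpa using ha⟩

/-- Exactness of `Hom(Z', Z) ⟶ E(Z', X) ⟶ E(Z', Y)`. -/
lemma IsTriangle.exists_pull (h : S.IsTriangle x y δ) {Z' : C} (θ : Ext S.E Z' X)
    (hθ : push x θ = 0) : ∃ t : Z' ⟶ Z, pull t δ = θ := by
  obtain ⟨M, m, n, hM⟩ := S.exists_isTriangle θ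
  obtain ⟨f, hf⟩ := (hM.push_eq_zero_iff x).1 hθ
  obtain ⟨c, -, hc⟩ := S.et3 hM h (𝟙 X) f (by simp [hf])
  exact ⟨c, by simpa using hc.symm⟩

end

lemma ext_injective_eq_zero {I : C} (hI : S.injectives I) {A : C} (θ : Ext S.E A I) : θ = 0 := by
  obtain ⟨M, m, n, hM⟩ := S.exists_isTriangle θ
  simpa using (hM.push_eq_zero_iff (𝟙 I)).2 (hI m n θ hM (𝟙 I))

lemma ext_projective_eq_zero {P : C} (hP : S.projectives P) {A : C} (θ : Ext S.E P A) : θ = 0 := by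
  obtain ⟨M, m, n, hM⟩ := S.exists_isTriangle θ
  simpa using (hM.pull_eq_zero_iff (𝟙 P)).2 (hP m n θ hM (𝟙 P))

/-- If `x : X ⟶ Y` is an inflation, then so is `(f, x) : X ⟶ W ⊞ Y` for every `f : X ⟶ W`. -/
lemma IsTriangle.exists_isTriangle_lift {X Y Z : C} {x : X ⟶ Y} {y : Y ⟶ Z} {δ : Ext S.E Z X}
    (h : S.IsTriangle x y δ) {W : C} (f : X ⟶ W) :
    ∃ (A : C) (p : W ⊞ Y ⟶ A) (θ : Ext S.E A X), S.IsTriangle (biprod.lift f x) p θ := by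
  have h₁ : S.IsTriangle (biprod.lift (𝟙 X) f) (biprod.snd - biprod.fst ≫ f) (0 : Ext S.E W X) :=
    (isTriangle_split W X).of_iso
      ⟨biprod.lift biprod.fst (biprod.snd + biprod.fst ≫ f),
        biprod.lift biprod.fst (biprod.snd - biprod.fst ≫ f),
        by ext <;> simp, by ext <;> simp⟩ (by ext <;> simp) (by ext <;> simp)
  have h₂ := S.s_sum (isTriangle_id_zero (S := S) W (isZero_zero C)) h
  have h₁' : S.IsTriangle (biprod.lift f (𝟙 X)) (biprod.fst - biprod.snd ≫ f) (0 : Ext S.E W X) :=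
    h₁.of_iso (biprod.braiding _ _) (by ext <;> simp) (by ext <;> simp)
  -- The map (f, x) is the composite of the split inflation (f, 𝟙) and the inflation 𝟙 ⊞ x.
  obtain ⟨A, -, -, p, θ, hA, -⟩ := S.et4 h₁' h₂
  exact ⟨A, p, θ, hA.trans (by congr 1; ext <;> simp)⟩

end ExtriangulatedStructure

end Extriang

/-! ### Presentations of functors by a universal element -/

namespace Extriang

section FinPres

variable {D : Type*} [Category.{v} D] [Preadditive D]

/-- The element `p` of `F(S₂)` exhibits the functor `F` as the cokernel of `Hom(g, -)`. -/
structure Presents (F : D ⥤ AddCommGrpCat.{v}) {S₂ S₁ : D} (g : S₂ ⟶ S₁) (p : F.obj S₂) :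
    Prop where
  map_add : ∀ {X Y : D} (f f' : X ⟶ Y) (z : F.obj X),
    (F.map (f + f')).hom z = (F.map f).hom z + (F.map f').hom z
  surj : ∀ {Y : D} (z : F.obj Y), ∃ x : S₂ ⟶ Y, (F.map x).hom p = z
  map_eq_zero_iff : ∀ {Y : D} (x : S₂ ⟶ Y), (F.map x).hom p = 0 ↔ ∃ y : S₁ ⟶ Y, g ≫ y = x

variable {F F' : D ⥤ AddCommGrpCat.{v}} {S₂ S₁ : D} {g : S₂ ⟶ S₁} {p : F.obj S₂}

namespace Presents

lemma map_sub (h : Presents F g p) {X Y : D} (f f' : X ⟶ Y) (z : F.obj X) :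
    (F.map (f - f')).hom z = (F.map f).hom z - (F.map f').hom z := by
  rw [eq_sub_iff_add_eq, ← h.map_add, sub_add_cancel]

lemma map_eq_zero (h : Presents F g p) : (F.map g).hom p = 0 :=
  (h.map_eq_zero_iff g).2 ⟨𝟙 _, by simp⟩

lemma map_app_eq_zero (h : Presents F g p) (η : F ⟶ F') :
    (F'.map g).hom ((η.app S₂).hom p) = 0 := by
  have h₁ := congrArg (fun f => f.hom p) (η.naturality g)
  simp only [AddCommGrpCat.hom_comp, AddMonoidHom.comp_apply] at h₁
  rw [← h₁, h.map_eq_zero, _root_.map_zero]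

/-- Since g factors back through `g ≫ σ`, both have the same image in Hom(S₂, -). This replaces the
target of a presentation by a smaller one. -/
lemma of_factor (h : Presents F g p) {S₁' : D} (σ : S₁ ⟶ S₁') (τ : S₁' ⟶ S₁)
    (hg : (g ≫ σ) ≫ τ = g) : Presents F (g ≫ σ) p :=
  ⟨h.map_add, h.surj, fun x => (h.map_eq_zero_iff x).trans
    ⟨fun ⟨y, hy⟩ => ⟨τ ≫ y, by rw [← Category.assoc, hg, hy]⟩,
      fun ⟨y, hy⟩ => ⟨σ ≫ y, by rw [← hy, Category.assoc]⟩⟩⟩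

lemma of_arrow_iso (h : Presents F g p) {S₂' S₁' : D} {g' : S₂' ⟶ S₁'} (l : S₂ ≅ S₂')
    (σ : S₁ ≅ S₁') (hg : l.hom ≫ g' = g ≫ σ.hom) : Presents F g' ((F.map l.hom).hom p) := by
  have key : ∀ {Y : D} (x : S₂' ⟶ Y),
      (F.map x).hom ((F.map l.hom).hom p) = (F.map (l.hom ≫ x)).hom p := by simp
  refine ⟨h.map_add, fun {Y} z => ?_, fun {Y} x => ?_⟩
  · obtain ⟨x, rfl⟩ := h.surj z
    exact ⟨l.inv ≫ x, by rw [key, Iso.hom_inv_id_assoc]⟩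
  · rw [key, h.map_eq_zero_iff]
    constructor
    · rintro ⟨y, hy⟩
      refine ⟨σ.inv ≫ y, ?_⟩
      rw [← cancel_epi l.hom, reassoc_of% hg, Iso.hom_inv_id_assoc, hy]
    · rintro ⟨y, rfl⟩
      exact ⟨σ.hom ≫ y, by rw [reassoc_of% hg]⟩

/-- A natural transformation from `F` is determined by the image of `p`. -/
lemma hom_ext (h : Presents F g p) {η η' : F ⟶ F'} (e : (η.app S₂).hom p = (η'.app S₂).hom p) :
    η = η' := by
  ext Y z
  obtain ⟨x, rfl⟩ := h.surj z
  have h₁ := congrArg (fun f => f.hom p) (η.naturality x)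
  have h₂ := congrArg (fun f => f.hom p) (η'.naturality x)
  simp only [AddCommGrpCat.hom_comp, AddMonoidHom.comp_apply] at h₁ h₂
  rw [h₁, h₂, e]

/-- The universal property of `F`. -/
lemma exists_hom (h : Presents F g p)
    (hF' : ∀ {X Y : D} (f f' : X ⟶ Y) (z : F'.obj X),
      (F'.map (f + f')).hom z = (F'.map f).hom z + (F'.map f').hom z)
    (q : F'.obj S₂) (hq : (F'.map g).hom q = 0) :
    ∃ η : F ⟶ F', (η.app S₂).hom p = q := by
  have key : ∀ {Y : D} (x : S₂ ⟶ Y), (F.map x).hom p = 0 → (F'.map x).hom q = 0 := by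
    intro Y x hx
    obtain ⟨y, rfl⟩ := (h.map_eq_zero_iff x).1 hx
    simp [hq]
  have key' : ∀ {Y : D} (x x' : S₂ ⟶ Y), (F.map x).hom p = (F.map x').hom p →
      (F'.map x).hom q = (F'.map x').hom q := by
    intro Y x x' hx
    have h₁ := key (x - x') (by rw [h.map_sub, hx, sub_self])
    have h₂ := hF' (x - x') x' q
    rwa [sub_add_cancel, h₁, zero_add] at h₂
  choose φ hφ using fun (Y : D) (z : F.obj Y) => h.surj z
  refine ⟨{ app := fun Y => AddCommGrpCat.ofHom
              (AddMonoidHom.mk' (fun z => (F'.map (φ Y z)).hom q) ?_), naturality := ?_ }, ?_⟩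
  · intro z z'
    rw [← hF']
    exact key' _ _ (by rw [h.map_add, hφ, hφ, hφ])
  · intro X Y f
    ext z
    have := key' (φ Y ((F.map f).hom z)) (φ X z ≫ f) (by simp [hφ])
    simpa using this
  · have := key' (φ S₂ p) (𝟙 _) (by simp [hφ])
    simpa using this

lemma nonempty_iso (h : Presents F g p) {p' : F'.obj S₂} (h' : Presents F' g p') :
    Nonempty (F ≅ F') := by
  obtain ⟨η, hη⟩ := h.exists_hom h'.map_add p' h'.map_eq_zero
  obtain ⟨η', hη'⟩ := h'.exists_hom h.map_add p h.map_eq_zero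
  exact ⟨⟨η, η', h.hom_ext (by simp [hη, hη']), h'.hom_ext (by simp [hη, hη'])⟩⟩

lemma of_iso (h : Presents F g p) (e : F ≅ F') : Presents F' g ((e.hom.app S₂).hom p) := by
  have nat : ∀ {X Y : D} (x : X ⟶ Y) (z : F.obj X),
      (F'.map x).hom ((e.hom.app X).hom z) = (e.hom.app Y).hom ((F.map x).hom z) := fun x z =>
    (congrArg (fun f => f.hom z) (e.hom.naturality x)).symm
  have inv : ∀ {X : D} (z : F'.obj X), (e.hom.app X).hom ((e.inv.app X).hom z) = z := fun {X} z =>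
    congrArg (fun f => f.hom z) (e.inv_hom_id_app X)
  have inv' : ∀ {X : D} (z : F.obj X), (e.inv.app X).hom ((e.hom.app X).hom z) = z := fun {X} z =>
    congrArg (fun f => f.hom z) (e.hom_inv_id_app X)
  refine ⟨fun f f' z => ?_, fun {Y} z => ?_, fun {Y} x => ?_⟩
  · rw [← inv z, nat, nat, nat, h.map_add, _root_.map_add]
  · obtain ⟨x, hx⟩ := h.surj ((e.inv.app Y).hom z)
    exact ⟨x, by rw [nat, hx, inv]⟩
  · rw [nat, ← h.map_eq_zero_iff]
    constructor
    · intro hx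
      rw [← inv' ((F.map x).hom p), hx, _root_.map_zero]
    · intro hx
      rw [hx, _root_.map_zero]

/-- Cokernels of functors are computed pointwise; p is the class of the identity of S₂. -/
lemma cokernel (g : S₂ ⟶ S₁) :
    ∃ p : (cokernel (preadditiveCoyoneda.map g.op)).obj S₂,
      Presents (cokernel (preadditiveCoyoneda.map g.op)) g p := by
  set π := cokernel.π (preadditiveCoyoneda.map g.op) with hπ
  have nat : ∀ {X Y : D} (x : X ⟶ Y) (z : S₂ ⟶ X),
      ((Limits.cokernel (preadditiveCoyoneda.map g.op)).map x).hom ((π.app X).hom z) =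
        (π.app Y).hom (z ≫ x) := fun x z =>
    (congrArg (fun f => f.hom z) (π.naturality x)).symm
  have surj : ∀ (Y : D), Function.Surjective (π.app Y).hom := fun Y =>
    (AddCommGrpCat.epi_iff_surjective _).1 inferInstance
  have ex : ∀ (Y : D) (x : S₂ ⟶ Y), (π.app Y).hom x = 0 ↔ ∃ y : S₁ ⟶ Y, g ≫ y = x := by
    intro Y x
    have h₁ := ShortComplex.exact_cokernel (preadditiveCoyoneda.map g.op)
    have h₂ := h₁.map ((evaluation D AddCommGrpCat.{v}).obj Y)
    rw [ShortComplex.ab_exact_iff] at h₂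
    constructor
    · intro hx
      exact h₂ x hx
    · rintro ⟨y, rfl⟩
      exact congrArg (fun f => (f.app Y).hom y) (cokernel.condition (preadditiveCoyoneda.map g.op))
  refine ⟨(π.app S₂).hom (𝟙 S₂), fun {X Y} f f' z => ?_, fun {Y} z => ?_, fun {Y} x => ?_⟩
  · obtain ⟨z, rfl⟩ := surj X z
    refine (nat (f + f') z).trans (Eq.trans ?_ (congrArg₂ (· + ·) (nat f z) (nat f' z)).symm)
    exact (congrArg _ (Preadditive.comp_add _ _ _ _ _ _)).trans (_root_.map_add (π.app Y).hom _ _)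
  · obtain ⟨x, rfl⟩ := surj Y z
    exact ⟨x, (nat _ _).trans (congrArg _ (Category.id_comp _))⟩
  · rw [← ex]
    exact Eq.congr_left ((nat x (𝟙 S₂)).trans (congrArg (π.app Y).hom (Category.id_comp x)))

end Presents

lemma finPres_iff : finPres D F ↔ ∃ (S₂ S₁ : D) (g : S₂ ⟶ S₁) (p : F.obj S₂), Presents F g p := by
  constructor
  · rintro ⟨S₂, S₁, g, ⟨e⟩⟩
    obtain ⟨p, hp⟩ := Presents.cokernel g
    exact ⟨S₂, S₁, g, _, hp.of_iso e.symm⟩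
  · rintro ⟨S₂, S₁, g, p, hp⟩
    obtain ⟨p', hp'⟩ := Presents.cokernel g
    exact ⟨S₂, S₁, g, hp.nonempty_iso hp'⟩

end FinPres

end Extriang

/-! ### Krull–Schmidt categories and Fitting's lemma -/

namespace Extriang

section KrullSchmidt

variable {C : Type u} [Category.{v} C]

/-- The endomorphism `e` is the composite of a retraction and its section. -/
def Splits {X : C} (e : X ⟶ X) : Prop :=
  ∃ (Y : C) (i : Y ⟶ X) (q : X ⟶ Y), i ≫ q = 𝟙 Y ∧ q ≫ i = e

lemma Splits.of_conj {X Y : C} (φ : X ≅ Y) {e : X ⟶ X} (h : Splits (φ.inv ≫ e ≫ φ.hom)) :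
    Splits e := by
  obtain ⟨Z, i, q, h₁, h₂⟩ := h
  refine ⟨Z, i ≫ φ.inv, φ.hom ≫ q, by simp [h₁], ?_⟩
  rw [Category.assoc, reassoc_of% h₂]
  simp

variable [Preadditive C]

lemma isIso_or_isIso_one_sub {Y : C} [IsLocalRing (End Y)] (f : Y ⟶ Y) :
    IsIso f ∨ IsIso (𝟙 Y - f) := by
  have := IsLocalRing.isUnit_or_isUnit_of_add_one (R := End Y) (a := f) (b := 𝟙 Y - f)
    (add_sub_cancel f (𝟙 Y))
  rwa [isUnit_iff_isIso, isUnit_iff_isIso] at this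

variable [HasFiniteBiproducts C]

/-- Such an e sends `inl` to itself and `inr` to c on Y plus d on X. Idempotence gives `d ≫ d = d`
and `d ≫ c = 0`, so splittings of d and 𝟙 - d yield those of e and 𝟙 - e. -/
lemma splits_of_lower_triangular {Y X : C} {e : Y ⊞ X ⟶ Y ⊞ X} (he : e ≫ e = e)
    (hX : ∀ d : X ⟶ X, d ≫ d = d → Splits d) (h : biprod.inl ≫ e = biprod.inl) :
    Splits e ∧ Splits (𝟙 _ - e) := by
  obtain ⟨c, hc⟩ : ∃ c : X ⟶ Y, c = biprod.inr ≫ e ≫ biprod.fst := ⟨_, rfl⟩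
  obtain ⟨d, hd⟩ : ∃ d : X ⟶ X, d = biprod.inr ≫ e ≫ biprod.snd := ⟨_, rfl⟩
  have hr : biprod.inr ≫ e = c ≫ biprod.inl + d ≫ biprod.inr := by
    ext <;> simp [hc, hd]
  have hr' : (biprod.inr ≫ e) ≫ e = biprod.inr ≫ e := by rw [Category.assoc, he]
  rw [hr, Preadditive.add_comp, Category.assoc, Category.assoc, h, hr] at hr'
  have hdc : d ≫ c = 0 := by simpa using hr' =≫ biprod.fst
  have hdd : d ≫ d = d := by simpa using hr' =≫ biprod.snd
  obtain ⟨Z, i, q, hiq, hqi⟩ := hX d hdd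
  obtain ⟨W, j, r, hjr, hrj⟩ := hX (𝟙 X - d) (by simp [hdd])
  have hic : i ≫ c = 0 := by
    have : i = i ≫ d := by rw [← hqi, reassoc_of% hiq]
    rw [this, Category.assoc, hdc, comp_zero]
  have hrc : r ≫ j ≫ c = c := by
    rw [reassoc_of% hrj, Preadditive.sub_comp, hdc]
    simp
  have hjd : j ≫ d = 0 := by
    have : j ≫ (𝟙 X - d) = j := by rw [← hrj, reassoc_of% hjr]
    simpa using this
  constructor
  · refine ⟨Y ⊞ Z, biprod.map (𝟙 Y) i, biprod.desc biprod.inl (biprod.lift c q), ?_, ?_⟩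
    · ext <;> simp [hiq, hic]
    · apply biprod.hom_ext'
      · rw [h]; ext <;> simp
      · rw [hr]; ext <;> simp [hqi]
  · refine ⟨W, biprod.lift (-(j ≫ c)) j, biprod.desc 0 r, by simp [hjr], ?_⟩
    apply biprod.hom_ext'
    · simp [h]
    · rw [Preadditive.comp_sub, hr]; ext <;> simp [hrj, hrc]

/-- An invertible corner allows the change of basis that replaces `inl` by `inl ≫ e`, which e fixes;
this is the triangular case. -/
lemma splits_of_isIso_corner {Y X : C} {e : Y ⊞ X ⟶ Y ⊞ X} (he : e ≫ e = e)
    (hX : ∀ d : X ⟶ X, d ≫ d = d → Splits d) [IsIso (biprod.inl ≫ e ≫ biprod.fst)] :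
    Splits e ∧ Splits (𝟙 _ - e) := by
  set u : Y ⟶ Y := biprod.inl ≫ e ≫ biprod.fst with hu
  set w : Y ⟶ X := biprod.inl ≫ e ≫ biprod.snd with hw
  have hl : biprod.inl ≫ e = u ≫ biprod.inl + w ≫ biprod.inr := by
    ext <;> simp [hu, hw]
  let φ : Y ⊞ X ≅ Y ⊞ X :=
    { hom := biprod.lift (biprod.fst ≫ inv u) (biprod.snd - biprod.fst ≫ inv u ≫ w)
      inv := biprod.desc (biprod.lift u w) biprod.inr
      hom_inv_id := by ext <;> simp
      inv_hom_id := by ext <;> simp }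
  have hφ : biprod.inl ≫ φ.inv = biprod.inl ≫ e := by
    rw [hl]; ext <;> simp [φ]
  have key : biprod.inl ≫ φ.inv ≫ e ≫ φ.hom = biprod.inl := by
    rw [reassoc_of% hφ, reassoc_of% he, ← reassoc_of% hφ]
    simp
  obtain ⟨h₁, h₂⟩ := splits_of_lower_triangular (e := φ.inv ≫ e ≫ φ.hom)
    (by simp [reassoc_of% he]) hX key
  exact ⟨h₁.of_conj, Splits.of_conj φ (by simpa using h₂)⟩

/-- The decomposition of a finite biproduct into the first summand and the others. -/
noncomputable def biproductSuccIso {n : ℕ} (Y : Fin (n + 1) → C) :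
    (⨁ Y) ≅ Y 0 ⊞ ⨁ (fun i : Fin n => Y i.succ) where
  hom := biprod.lift (biproduct.π Y 0) (biproduct.lift fun i => biproduct.π Y i.succ)
  inv := biprod.desc (biproduct.ι Y 0) (biproduct.desc fun i => biproduct.ι Y i.succ)
  hom_inv_id := by
    rw [biprod.lift_desc, biproduct.lift_desc, ← biproduct.total, Fin.sum_univ_succ]
  inv_hom_id := by
    ext <;> simp [biproduct.ι_π, Fin.succ_ne_zero, (Fin.succ_ne_zero _).symm]

lemma isZero_biproduct_fin_zero (Y : Fin 0 → C) : IsZero (⨁ Y) := by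
  rw [IsZero.iff_id_eq_zero]
  ext i
  exact i.elim0

lemma splits_of_idem_biproduct {n : ℕ} (Y : Fin n → C) (hY : ∀ i, IsLocalRing (End (Y i)))
    (e : (⨁ Y) ⟶ ⨁ Y) (he : e ≫ e = e) : Splits e := by
  induction n with
  | zero => exact ⟨⨁ Y, 𝟙 _, 𝟙 _, by simp, (isZero_biproduct_fin_zero Y).eq_of_src _ _⟩
  | succ n ih =>
    have hX := ih (fun i => Y i.succ) fun i => hY i.succ
    apply Splits.of_conj (biproductSuccIso Y)
    set e' := (biproductSuccIso Y).inv ≫ e ≫ (biproductSuccIso Y).hom with he'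
    have hee : e' ≫ e' = e' := by simp [he', reassoc_of% he]
    have := hY 0
    -- The first summand has local endomorphism ring, so e' or 𝟙 - e' has an invertible corner;
    -- splitting an idempotent together with its complement covers both cases.
    rcases isIso_or_isIso_one_sub (biprod.inl ≫ e' ≫ biprod.fst) with h | h
    · exact (splits_of_isIso_corner hee hX).1
    · have : IsIso (biprod.inl ≫ (𝟙 _ - e') ≫ biprod.fst) := by
        convert h using 1
        simp
      have := (splits_of_isIso_corner (e := 𝟙 _ - e') (by simp [hee]) hX).2
      rwa [sub_sub_cancel] at this

/-- Krull--Schmidt categories are idempotent complete. -/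
lemma IsKrullSchmidt.splits (hKS : IsKrullSchmidt C) {X : C} (e : X ⟶ X) (he : e ≫ e = e) :
    Splits e := by
  obtain ⟨n, Y, hY, ⟨φ⟩⟩ := hKS X
  exact Splits.of_conj φ (splits_of_idem_biproduct Y hY _ (by simp [reassoc_of% he]))

/-- Complementary summands. -/
lemma IsKrullSchmidt.exists_iso_biprod (hKS : IsKrullSchmidt C) {X Y : C} (i : Y ⟶ X) (q : X ⟶ Y)
    (h : i ≫ q = 𝟙 Y) :
    ∃ (Z : C) (φ : X ≅ Y ⊞ Z), φ.hom ≫ biprod.fst = q ∧ biprod.inl ≫ φ.inv = i := by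
  obtain ⟨Z, j, r, hjr, hrj⟩ := hKS.splits (𝟙 X - q ≫ i) (by simp [reassoc_of% h])
  have hjq : j ≫ q = 0 := by
    have : j ≫ (𝟙 X - q ≫ i) = j := by rw [← hrj, reassoc_of% hjr]
    have := this =≫ q
    simpa [h] using this.symm
  have hir : i ≫ r = 0 := by
    have : (𝟙 X - q ≫ i) ≫ r = r := by rw [← hrj, Category.assoc, hjr, Category.comp_id]
    have := i ≫= this
    simpa [reassoc_of% h] using this.symm
  exact ⟨Z, ⟨biprod.lift q r, biprod.desc i j, by simp [hrj],
    by ext <;> simp [h, hjr, hjq, hir]⟩, by simp, by simp⟩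

lemma indecomposable_of_isLocalRing_end {Y : C} [IsLocalRing (End Y)] : Indecomposable Y := by
  have hne : (𝟙 Y : Y ⟶ Y) ≠ 0 := (one_ne_zero : (1 : End Y) ≠ 0)
  refine ⟨fun h => hne ((IsZero.iff_id_eq_zero _).1 h), fun U V φ => ?_⟩
  rcases isIso_or_isIso_one_sub (φ.hom ≫ biprod.fst ≫ biprod.inl ≫ φ.inv) with h | h
  · right
    rw [IsZero.iff_id_eq_zero]
    have : (biprod.inr ≫ φ.inv) = 0 := by
      rw [← cancel_mono (φ.hom ≫ biprod.fst ≫ biprod.inl ≫ φ.inv)]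
      simp
    have := this =≫ (φ.hom ≫ biprod.snd)
    simpa using this
  · left
    rw [IsZero.iff_id_eq_zero]
    have : (biprod.inl ≫ φ.inv) = 0 := by
      rw [← cancel_mono (𝟙 Y - φ.hom ≫ biprod.fst ≫ biprod.inl ≫ φ.inv)]
      simp
    have := this =≫ (φ.hom ≫ biprod.fst)
    simpa using this

/-- An indecomposable object is isomorphic to the first summand of its decomposition, whose
endomorphism ring is local. -/
lemma IsKrullSchmidt.isIso_or_isIso_one_sub (hKS : IsKrullSchmidt C) {A : C}
    (hA : Indecomposable A) (f : A ⟶ A) : IsIso f ∨ IsIso (𝟙 A - f) := by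
  obtain ⟨n, Y, hY, ⟨φ⟩⟩ := hKS A
  obtain _ | n := n
  · exact (hA.1 ((isZero_biproduct_fin_zero Y).of_iso φ)).elim
  have := hY 0
  rcases hA.2 _ _ (φ ≪≫ biproductSuccIso Y) with h | h
  · exact (indecomposable_of_isLocalRing_end.1 h).elim
  · let ψ : A ≅ Y 0 := φ ≪≫ biproductSuccIso Y ≪≫
      ⟨biprod.fst, biprod.inl,
        biprod.hom_ext' _ _ (by simp) (h.eq_of_src _ _), by simp⟩
    have conj : ∀ g : A ⟶ A, IsIso (ψ.inv ≫ g ≫ ψ.hom) → IsIso g := fun g hg => by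
      have : g = ψ.hom ≫ (ψ.inv ≫ g ≫ ψ.hom) ≫ ψ.inv := by simp
      rw [this]
      infer_instance
    rcases Extriang.isIso_or_isIso_one_sub (ψ.inv ≫ f ≫ ψ.hom) with h | h
    · exact Or.inl (conj _ h)
    · exact Or.inr (conj _ (by simpa using h))

end KrullSchmidt

/-- Fitting's lemma for an element of a finite dimensional algebra. -/
lemma exists_fitting_idempotent {k R : Type*} [Field k] [Ring R] [Algebra k R] [Module.Finite k R]
    (x : R) : ∃ (e y : R) (m : ℕ), e * e = e ∧ x * y = e ∧ y * x = e ∧ (1 - e) * x ^ m = 0 := by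
  open Polynomial in
  have hint := Algebra.IsIntegral.isIntegral (R := k) x
  obtain ⟨q, hq, hq0⟩ := exists_eq_pow_rootMultiplicity_mul_and_not_dvd (minpoly k x)
    (minpoly.ne_zero hint) 0
  set m := rootMultiplicity 0 (minpoly k x)
  rw [C_0, sub_zero] at hq hq0
  -- The exponent m + 1 instead of m makes e a multiple of x even when m = 0.
  have hco : IsCoprime (X ^ (m + 1) : k[X]) q :=
    ((prime_X (R := k)).coprime_iff_not_dvd.2 hq0).pow_left
  obtain ⟨a, b, hab⟩ := hco
  have h0 : aeval x (X ^ m * q) = 0 := by rw [← hq, minpoly.aeval]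
  have h1 : (1 : R) - aeval x (a * X ^ (m + 1)) = aeval x (b * q) := by
    rw [← map_one (aeval (R := k) x), ← hab, ← map_sub]
    congr 1
    ring
  refine ⟨aeval x (a * X ^ (m + 1)), aeval x (a * X ^ m), m, ?_, ?_, ?_, ?_⟩
  · have : aeval x (a * X ^ (m + 1)) * (1 - aeval x (a * X ^ (m + 1))) = 0 := by
      rw [h1, ← map_mul, show a * X ^ (m + 1) * (b * q) = a * b * X * (X ^ m * q) by ring,
        map_mul, h0, mul_zero]
    rwa [mul_sub, mul_one, sub_eq_zero, eq_comm] at this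
  · rw [show a * X ^ (m + 1) = X * (a * X ^ m) by ring, map_mul _ X, aeval_X]
  · rw [show a * X ^ (m + 1) = a * X ^ m * X by ring, map_mul _ _ X, aeval_X]
  · rw [h1, ← aeval_X_pow (R := k) x, ← map_mul, show b * q * X ^ m = b * (X ^ m * q) by ring,
      map_mul, h0, mul_zero]

end Extriang

/-! ### Morphisms to Σ𝓣 modulo injectives, and finite presentation -/

namespace Extriang

namespace ExtriangulatedStructure

variable {C : Type u} [Category.{v} C] [Preadditive C] [HasFiniteBiproducts C]
variable {S : ExtriangulatedStructure.{w} C} {T : ObjectProperty C}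

instance : S.bar.Additive := Quotient.functor_additive S.injRel S.injRel_add

lemma bar_map_eq_iff {X Y : C} {f g : X ⟶ Y} :
    S.bar.map f = S.bar.map g ↔ S.FactorsInj (f - g) :=
  Quotient.functor_map_eq_iff S.injRel f g

lemma bar_map_eq_zero_iff {X Y : C} {f : X ⟶ Y} : S.bar.map f = 0 ↔ S.FactorsInj f := by
  rw [← S.bar.map_zero, bar_map_eq_iff, sub_zero]

lemma FactorsInj.comp_left {X Y Z : C} {f : Y ⟶ Z} (hf : S.FactorsInj f) (e : X ⟶ Y) :
    S.FactorsInj (e ≫ f) := by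
  rw [← bar_map_eq_zero_iff] at *
  rw [Functor.map_comp, hf, comp_zero]

variable (S T) in
/-- `Ext(I, X) = 0` for `I` injective and `X` in `T`. -/
def ExtVanishing : Prop :=
  ∀ I X : C, S.injectives I → T X → ∀ δ : Ext S.E I X, δ = 0

variable (S T) in
/-- The triangle `X ⟶ I ⟶ Y` exhibits `Y` as an object of `Σ T`. -/
structure IsSusp {X I Y : C} (x : X ⟶ I) (y : I ⟶ Y) (δ : Ext S.E Y X) : Prop where
  mem : T X
  inj : S.injectives I
  tri : S.IsTriangle x y δ

lemma susp_iff {Y : C} : S.susp T Y ↔ ∃ (X I : C) (x : X ⟶ I) (y : I ⟶ Y) (δ : Ext S.E Y X),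
    S.IsSusp T x y δ :=
  ⟨fun ⟨X, I, x, y, δ, h₁, h₂, h₃⟩ => ⟨X, I, x, y, δ, h₁, h₂, h₃⟩,
    fun ⟨X, I, x, y, δ, h₁, h₂, h₃⟩ => ⟨X, I, x, y, δ, h₁, h₂, h₃⟩⟩

lemma EnoughInjectives.exists_isSusp (hinj : S.EnoughInjectives) {X : C} (hX : T X) :
    ∃ (I Y : C) (x : X ⟶ I) (y : I ⟶ Y) (δ : Ext S.E Y X), S.IsSusp T x y δ := by
  obtain ⟨I, Y, x, y, δ, h₁, h₂⟩ := hinj X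
  exact ⟨I, Y, x, y, δ, hX, h₁, h₂⟩

namespace IsSusp

variable {X I Y : C} {x : X ⟶ I} {y : I ⟶ Y} {δ : Ext S.E Y X}

lemma susp (h : S.IsSusp T x y δ) : S.susp T Y := susp_iff.2 ⟨X, I, x, y, δ, h⟩

lemma exists_pull (h : S.IsSusp T x y δ) {A : C} (θ : Ext S.E A X) :
    ∃ f : A ⟶ Y, pull f δ = θ :=
  h.tri.exists_pull θ (ext_injective_eq_zero h.inj _)

/-- With `exists_pull`, this identifies Hom(A, Y) modulo injectives with E(A, X). The vanishing of
E(𝓘, 𝓣) ensures that maps through any injective, not only through I, pull δ back to zero. -/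
lemma pull_eq_zero_iff (h : S.IsSusp T x y δ) (hE : S.ExtVanishing T) {A : C} (f : A ⟶ Y) :
    pull f δ = 0 ↔ S.FactorsInj f := by
  constructor
  · intro hf
    obtain ⟨f', rfl⟩ := (h.tri.pull_eq_zero_iff f).1 hf
    exact ⟨I, f', y, h.inj, rfl⟩
  · rintro ⟨J, p, q, hJ, rfl⟩
    rw [pull_comp, hE J X hJ h.mem (pull q δ), pull_zero_right]

lemma pull_eq_iff (h : S.IsSusp T x y δ) (hE : S.ExtVanishing T) {A : C} (f g : A ⟶ Y) :
    pull f δ = pull g δ ↔ S.bar.map f = S.bar.map g := by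
  rw [bar_map_eq_iff, ← h.pull_eq_zero_iff hE, pull_sub, sub_eq_zero]

lemma exists_push (h : S.IsSusp T x y δ) (hE : S.ExtVanishing T) {X' : C} (hX' : T X')
    (θ : Ext S.E Y X') : ∃ t : X ⟶ X', push t δ = θ :=
  h.tri.exists_push θ (hE _ _ h.inj hX' _)

lemma push_eq_zero (h : S.IsSusp T x y δ) {X' : C} (f : X ⟶ X') (hf : push f δ = 0) :
    S.FactorsInj f := by
  obtain ⟨f', rfl⟩ := (h.tri.push_eq_zero_iff f).1 hf
  exact ⟨I, x, f', h.inj, rfl⟩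

end IsSusp

lemma FactorsInj.push_eq_zero {X X' Z : C} {f : X ⟶ X'} (hf : S.FactorsInj f) (δ : Ext S.E Z X) :
    push f δ = 0 := by
  obtain ⟨J, p, q, hJ, rfl⟩ := hf
  rw [push_comp, ext_injective_eq_zero hJ (push p δ), push_zero_right]

variable (S T) in
/-- An object of `Σ T`, viewed in `C / I`. -/
abbrev suspObj (Y : C) (hY : S.susp T Y) : S.SuspBar T := ⟨S.bar.obj Y, hY⟩

/-- The morphism in `Σ T / I` given by a morphism of `C`. -/
abbrev suspHom {Y Y' : C} {hY : S.susp T Y} {hY' : S.susp T Y'} (f : Y ⟶ Y') :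
    S.suspObj T Y hY ⟶ S.suspObj T Y' hY' :=
  ObjectProperty.homMk (S.bar.map f)

lemma suspHom_surjective {Y Y' : S.SuspBar T} (f : Y ⟶ Y') :
    ∃ g : Y.obj.as ⟶ Y'.obj.as, suspHom (hY := Y.property) (hY' := Y'.property) g = f := by
  obtain ⟨g, hg⟩ := S.bar.map_surjective (X := Y.obj.as) (Y := Y'.obj.as) f.hom
  exact ⟨g, InducedCategory.hom_ext hg⟩

variable (S T) in
/-- The value of `Hom(-, Σ T)` at `A`. -/
abbrev homSuspObj (A : C) : S.SuspBar T ⥤ AddCommGrpCat.{v} := (S.homSusp T).obj (op A)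

lemma homSusp_map_eq_iff {A A' : C} (f g : A ⟶ A') :
    (S.homSusp T).map f.op = (S.homSusp T).map g.op ↔
      ∀ (Y : C), S.susp T Y → ∀ y : A' ⟶ Y, S.bar.map (f ≫ y) = S.bar.map (g ≫ y) := by
  constructor
  · intro h Y hY y
    have : S.bar.map f ≫ S.bar.map y = S.bar.map g ≫ S.bar.map y :=
      congrArg (fun η => (η.app (S.suspObj T Y hY)).hom (S.bar.map y)) h
    simpa using this
  · intro h
    ext Y z
    obtain ⟨y, rfl⟩ := S.bar.map_surjective (X := A') (Y := Y.obj.as) z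
    have := h Y.obj.as Y.property y
    rw [Functor.map_comp, Functor.map_comp] at this
    exact this

instance : (S.homSusp T).Additive where
  map_add {A A'} f g := by
    ext Y z
    have : S.bar.map (f.unop + g.unop) ≫ (show S.bar.obj A.unop ⟶ Y.obj from z) =
        S.bar.map f.unop ≫ z + S.bar.map g.unop ≫ z := by
      rw [Functor.map_add, Preadditive.add_comp]
    exact this

lemma homSusp_map_eq_zero_iff {A A' : C} (f : A ⟶ A') :
    (S.homSusp T).map f.op = 0 ↔
      ∀ (Y : C), S.susp T Y → ∀ y : A' ⟶ Y, S.FactorsInj (f ≫ y) := by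
  have h0 : (S.homSusp T).map (0 : A ⟶ A').op = 0 := (S.homSusp T).map_zero _ _
  rw [← h0, homSusp_map_eq_iff]
  simp only [zero_comp, Functor.map_zero, bar_map_eq_zero_iff]

lemma homSuspObj_map_add (A : C) {X Y : S.SuspBar T} (f f' : X ⟶ Y)
    (z : (S.homSuspObj T A).obj X) :
    ((S.homSuspObj T A).map (f + f')).hom z =
      ((S.homSuspObj T A).map f).hom z + ((S.homSuspObj T A).map f').hom z :=
  Preadditive.comp_add _ _ _ (show S.bar.obj A ⟶ X.obj from z) f.hom f'.hom

lemma presents_homSuspObj_iff {A S₂ S₁ : C} {hS₂ : S.susp T S₂} {hS₁ : S.susp T S₁}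
    (r : A ⟶ S₂) (g : S₂ ⟶ S₁) :
    Presents (S.homSuspObj T A) (suspHom (hY := hS₂) (hY' := hS₁) g) (S.bar.map r) ↔
      (∀ Y, S.susp T Y → ∀ y : A ⟶ Y, ∃ x : S₂ ⟶ Y, S.bar.map (r ≫ x) = S.bar.map y) ∧
      ∀ Y, S.susp T Y → ∀ x : S₂ ⟶ Y, S.FactorsInj (r ≫ x) ↔
        ∃ y : S₁ ⟶ Y, S.bar.map (g ≫ y) = S.bar.map x := by
  constructor
  · intro h
    refine ⟨fun Y hY y => ?_, fun Y hY x => ?_⟩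
    · obtain ⟨x, hx⟩ := h.surj (Y := S.suspObj T Y hY) (S.bar.map y)
      obtain ⟨x, rfl⟩ := suspHom_surjective x
      exact ⟨x, (S.bar.map_comp r x).trans hx⟩
    · have := h.map_eq_zero_iff (Y := S.suspObj T Y hY) (suspHom x)
      rw [← bar_map_eq_zero_iff, S.bar.map_comp]
      refine this.trans ⟨?_, ?_⟩
      · rintro ⟨y, hy⟩
        obtain ⟨y, rfl⟩ := suspHom_surjective y
        exact ⟨y, (S.bar.map_comp g y).trans (congrArg (fun f => f.hom) hy)⟩
      · rintro ⟨y, hy⟩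
        exact ⟨suspHom y, InducedCategory.hom_ext ((S.bar.map_comp g y).symm.trans hy)⟩
  · rintro ⟨h₁, h₂⟩
    refine ⟨homSuspObj_map_add A, fun {Y} z => ?_, fun {Y} x => ?_⟩
    · obtain ⟨y, rfl⟩ := S.bar.map_surjective (X := A) (Y := Y.obj.as) z
      obtain ⟨x, hx⟩ := h₁ Y.obj.as Y.property y
      exact ⟨suspHom x, (S.bar.map_comp r x).symm.trans hx⟩
    · obtain ⟨x, rfl⟩ := suspHom_surjective x
      have := h₂ Y.obj.as Y.property x
      rw [← bar_map_eq_zero_iff, S.bar.map_comp] at this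
      refine Iff.trans this ⟨?_, ?_⟩
      · rintro ⟨y, hy⟩
        exact ⟨suspHom y, InducedCategory.hom_ext ((S.bar.map_comp g y).symm.trans hy)⟩
      · rintro ⟨y, hy⟩
        obtain ⟨y, rfl⟩ := suspHom_surjective y
        exact ⟨y, (S.bar.map_comp g y).trans (congrArg (fun f => f.hom) hy)⟩

/-- The functors `Hom(A, -)` on `Σ T` are finitely presented. -/
theorem finPres_homSuspObj (hproj : S.EnoughProjectives) (hinj : S.EnoughInjectives)
    (hcov : CovariantlyFinite T) (hE : S.ExtVanishing T) (A : C) :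
    finPres (S.SuspBar T) (S.homSuspObj T A) := by
  -- In terms of E(A, -) on 𝓣: every class is a pushforward of κ, hence of the generator `push u κ`.
  -- A map from T₀ to 𝓣 kills this generator exactly when it factors through m, hence through `m ≫
  -- l`. The maps r and g below are the translations of the generator and of this relation to Σ𝓣.
  obtain ⟨K, P, x, y, κ, hP, hκ⟩ := hproj A
  obtain ⟨T₀, u, hT₀, hu⟩ := hcov K
  obtain ⟨M, m, n, hM⟩ := S.exists_isTriangle (push u κ)
  obtain ⟨T₁, l, hT₁, hl⟩ := hcov M
  obtain ⟨I₂, S₂, i₂, j₂, δ₂, h₂⟩ := hinj.exists_isSusp hT₀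
  obtain ⟨I₁, S₁, i₁, j₁, δ₁, h₁⟩ := hinj.exists_isSusp hT₁
  obtain ⟨r, hr⟩ := h₂.exists_pull (push u κ)
  obtain ⟨g, hg⟩ := h₁.exists_pull (push (m ≫ l) δ₂)
  rw [finPres_iff]
  refine ⟨S.suspObj T S₂ h₂.susp, S.suspObj T S₁ h₁.susp, suspHom g, S.bar.map r,
    (presents_homSuspObj_iff r g).2 ⟨fun Y hY y' => ?_, fun Y hY x' => ?_⟩⟩
  · obtain ⟨X, I, i, j, δ, h⟩ := susp_iff.1 hY
    obtain ⟨w, hw⟩ := hκ.exists_push (pull y' δ) (ext_projective_eq_zero hP _)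
    obtain ⟨w', rfl⟩ := hu X w h.mem
    obtain ⟨z, hz⟩ := h.exists_pull (push w' δ₂)
    refine ⟨z, ?_⟩
    rw [← h.pull_eq_iff hE, pull_comp, hz, ← push_pull, hr, ← hw, push_comp]
  · obtain ⟨X, I, i, j, δ, h⟩ := susp_iff.1 hY
    rw [← h.pull_eq_zero_iff hE, pull_comp]
    constructor
    · intro hx
      obtain ⟨w, hw⟩ := h₂.exists_push hE h.mem (pull x' δ)
      rw [← hw, ← push_pull, hr, hM.push_eq_zero_iff] at hx
      obtain ⟨w', rfl⟩ := hx
      obtain ⟨w'', rfl⟩ := hl X w' h.mem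
      obtain ⟨z, hz⟩ := h.exists_pull (push w'' δ₁)
      refine ⟨z, ?_⟩
      rw [← h.pull_eq_iff hE, pull_comp, hz, ← push_pull, hg, ← push_comp, Category.assoc, hw]
    · rintro ⟨z, hz⟩
      obtain ⟨w, hw⟩ := h₁.exists_push hE h.mem (pull z δ)
      rw [← h.pull_eq_iff hE] at hz
      rw [← hz, pull_comp, ← hw, ← push_pull, hg, ← push_pull, ← push_pull, hr, push_comp,
        hM.push_inf, push_zero_right, push_zero_right]

end ExtriangulatedStructure

end Extriang

/-! ### Diagrams (∗), fullness and condition (a) -/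

namespace Extriang

namespace ExtriangulatedStructure

variable {C : Type u} [Category.{v} C] [Preadditive C] [HasFiniteBiproducts C]
variable {S : ExtriangulatedStructure.{w} C} {T : ObjectProperty C}

section Diagram

variable {T₂ T₁ A I S₂ S₁ : C} {a : T₂ ⟶ T₁} {h : T₁ ⟶ A} {b : T₂ ⟶ I} {c : I ⟶ S₂}
  {i : T₁ ⟶ I} {j : I ⟶ S₁} {r : A ⟶ S₂} {g : S₂ ⟶ S₁}

namespace IsDiagram

lemma susp_left (hd : S.IsDiagram a h b c i j r g) (hT₂ : T T₂) (hI : S.injectives I) :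
    S.susp T S₂ := by
  obtain ⟨-, -, -, δ₁, δ₂, ε₁, ε₂, -, h₂, -⟩ := hd
  exact susp_iff.2 ⟨_, _, _, _, _, hT₂, hI, h₂⟩

lemma susp_right (hd : S.IsDiagram a h b c i j r g) (hT₁ : T T₁) (hI : S.injectives I) :
    S.susp T S₁ := by
  obtain ⟨-, -, -, δ₁, δ₂, ε₁, ε₂, -, -, h₁, -⟩ := hd
  exact susp_iff.2 ⟨_, _, _, _, _, hT₁, hI, h₁⟩

lemma comp_zero (hd : S.IsDiagram a h b c i j r g) : r ≫ g = 0 := by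
  obtain ⟨-, -, -, δ₁, δ₂, ε₁, ε₂, -, -, -, h', -⟩ := hd
  exact h'.comp_zero

/-- Morphisms to `S₂` whose composite with `g` vanishes in `C / I` lift to `A`. -/
lemma exists_lift (hd : S.IsDiagram a h b c i j r g) (hE : S.ExtVanishing T) (hT₁ : T T₁) {X : C}
    (ρ : X ⟶ S₂) (hρ : S.FactorsInj (ρ ≫ g)) :
    ∃ f : X ⟶ A, S.bar.map (f ≫ r) = S.bar.map ρ := by
  obtain ⟨-, -, hj, δ₁, δ₂, ε₁, ε₂, -, h₂, h₁, h', -⟩ := hd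
  obtain ⟨J, p, q, hJ, hpq⟩ := hρ
  -- As E(J, T₁) = 0, q lifts along j = `c ≫ g`; subtracting the lift from ρ makes its composite
  -- with g vanish in C itself.
  obtain ⟨q', rfl⟩ := (h₁.pull_eq_zero_iff q).1 (hE _ _ hJ hT₁ _)
  obtain ⟨f, hf⟩ := h'.exists_lift (ρ - p ≫ q' ≫ c) (by simp [hj, ← hpq])
  refine ⟨f, ?_⟩
  rw [hf, bar_map_eq_iff, sub_sub_cancel_left]
  exact FactorsInj.neg ⟨J, p, q' ≫ c, hJ, rfl⟩

/-- A map from A to an injective extends along the inflation r, so x can be corrected to vanish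
exactly on r. This half of the presentation needs nothing of h. -/
lemma factorsInj_comp_iff (hd : S.IsDiagram a h b c i j r g) {Y : C} (x : S₂ ⟶ Y) :
    S.FactorsInj (r ≫ x) ↔ ∃ y : S₁ ⟶ Y, S.bar.map (g ≫ y) = S.bar.map x := by
  obtain ⟨-, -, -, δ₁, δ₂, ε₁, ε₂, -, -, -, h', -⟩ := hd
  constructor
  · rintro ⟨J, p, q, hJ, hpq⟩
    obtain ⟨p', rfl⟩ := hJ r g ε₂ h' p
    obtain ⟨y, hy⟩ := h'.exists_desc (x - p' ≫ q) (by simp [← hpq])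
    refine ⟨y, ?_⟩
    rw [hy, bar_map_eq_iff, sub_sub_cancel_left]
    exact FactorsInj.neg ⟨J, p', q, hJ, rfl⟩
  · rintro ⟨y, hy⟩
    rw [← bar_map_eq_zero_iff, S.bar.map_comp, ← hy, ← S.bar.map_comp, reassoc_of% h'.comp_zero,
      Limits.zero_comp, S.bar.map_zero]

/-- If `h ≫ y` vanishes modulo injectives, then h^*y^*δ = 0, so y^*δ is a pushforward of δ₁ = r^*δ₂.
Exchanging pushforward and pullback exhibits the factor through r. -/
lemma exists_factor (hd : S.IsDiagram a h b c i j r g) (hE : S.ExtVanishing T)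
    (hh : (S.homSusp T).map h.op = 0) {Y : C} (hY : S.susp T Y) (y : A ⟶ Y) :
    ∃ x : S₂ ⟶ Y, S.bar.map (r ≫ x) = S.bar.map y := by
  obtain ⟨-, -, -, δ₁, δ₂, ε₁, ε₂, h₀, h₂, -, -, hr, -⟩ := hd
  obtain ⟨X, J, u, v, δ, hδ⟩ := susp_iff.1 hY
  obtain ⟨t, ht⟩ := h₀.exists_push (pull y δ)
    (by rw [← pull_comp, hδ.pull_eq_zero_iff hE]; exact homSusp_map_eq_zero_iff h |>.1 hh Y hY y)
  obtain ⟨x, hx⟩ := hδ.exists_pull (push t δ₂)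
  refine ⟨x, ?_⟩
  rw [← hδ.pull_eq_iff hE, pull_comp, hx, ← push_pull, ← hr, ht]

/-- A diagram with `Hom(h, Σ T) = 0` yields a presentation of `Hom(A, -)`. -/
lemma presents (hd : S.IsDiagram a h b c i j r g) (hE : S.ExtVanishing T)
    (hS₂ : S.susp T S₂) (hS₁ : S.susp T S₁) (hh : (S.homSusp T).map h.op = 0) :
    Presents (S.homSuspObj T A) (suspHom (hY := hS₂) (hY' := hS₁) g) (S.bar.map r) :=
  (presents_homSuspObj_iff r g).2
    ⟨fun _ hY y => hd.exists_factor hE hh hY y, fun _ _ x => hd.factorsInj_comp_iff x⟩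

end IsDiagram

/-- Two composable inflations, the second one with injective target, complete to a diagram. -/
lemma IsTriangle.exists_isDiagram {δ₁ : Ext S.E A T₂} {ε₁ : Ext S.E S₁ T₁}
    (h₁ : S.IsTriangle a h δ₁) (h₂ : S.IsTriangle i j ε₁) :
    ∃ (S₂ : C) (c : I ⟶ S₂) (r : A ⟶ S₂) (g : S₂ ⟶ S₁) (δ₂ : Ext S.E S₂ T₂),
      S.IsDiagram a h (a ≫ i) c i j r g ∧ S.IsTriangle (a ≫ i) c δ₂ ∧
      push a δ₂ = pull g ε₁ := by
  obtain ⟨S₂, r, g, c, δ₂, h₃, h₄, h₅, h₆, h₇, h₈⟩ := S.et4 h₁ h₂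
  exact ⟨S₂, c, r, g, δ₂, ⟨rfl, h₄, h₅, δ₁, δ₂, ε₁, _, h₁, h₃, h₂, h₆, h₇.symm, rfl⟩, h₃, h₈⟩

end Diagram

variable (S T) in
/-- `A` occurs in a diagram with `T₁, T₂` in `T`, `I` injective and `Hom(h, Σ T) = 0`. -/
def HasPresentingDiagram (A : C) : Prop :=
  ∃ (T₂ T₁ I S₂ S₁ : C) (a : T₂ ⟶ T₁) (h : T₁ ⟶ A) (b : T₂ ⟶ I) (c : I ⟶ S₂)
    (i : T₁ ⟶ I) (j : I ⟶ S₁) (r : A ⟶ S₂) (g : S₂ ⟶ S₁),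
    S.IsDiagram a h b c i j r g ∧ T T₁ ∧ T T₂ ∧ S.injectives I ∧ (S.homSusp T).map h.op = 0

variable (S T) in
/-- All natural transformations from `Hom(A', -)` to functors `Hom(A, -)` are induced by
morphisms. -/
def FullAt (A' : C) : Prop :=
  ∀ (A : C) (η : S.homSuspObj T A' ⟶ S.homSuspObj T A), ∃ f : A ⟶ A', (S.homSusp T).map f.op = η

/-- A transformation is determined by the image ρ of r, which g kills; the weak kernel property of r
turns ρ into a morphism to A'. -/
lemma HasPresentingDiagram.fullAt (hE : S.ExtVanishing T) {A' : C}
    (hA' : S.HasPresentingDiagram T A') : S.FullAt T A' := by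
  obtain ⟨T₂, T₁, I, S₂, S₁, a, h, b, c, i, j, r, g, hd, hT₁, hT₂, hI, hh⟩ := hA'
  intro A η
  have hp := hd.presents hE (hd.susp_left hT₂ hI) (hd.susp_right hT₁ hI) hh
  obtain ⟨ρ, hρ⟩ := S.bar.map_surjective (X := A) (Y := S₂)
    ((η.app (S.suspObj T S₂ (hd.susp_left hT₂ hI))).hom (S.bar.map r))
  have hρg : S.FactorsInj (ρ ≫ g) := by
    rw [← bar_map_eq_zero_iff, S.bar.map_comp, hρ]
    exact hp.map_app_eq_zero η
  obtain ⟨f, hf⟩ := hd.exists_lift hE hT₁ ρ hρg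
  refine ⟨f, hp.hom_ext (Eq.trans ?_ hρ)⟩
  rw [← hf, S.bar.map_comp]
  rfl

lemma FullAt.of_isZero {A' : C} (h : IsZero (S.homSuspObj T A')) : S.FullAt T A' :=
  fun _ _ => ⟨0, h.eq_of_src _ _⟩

lemma FullAt.of_iso_biproduct {n : ℕ} {A' : C} {Y : Fin n → C} (φ : A' ≅ ⨁ Y)
    (h : ∀ k, S.FullAt T (Y k)) : S.FullAt T A' := by
  intro A η
  choose f hf using fun k => h k A ((S.homSusp T).map (φ.hom ≫ biproduct.π Y k).op ≫ η)
  refine ⟨∑ k, f k ≫ biproduct.ι Y k ≫ φ.inv, ?_⟩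
  have key : ∑ k, (φ.hom ≫ biproduct.π Y k) ≫ biproduct.ι Y k ≫ φ.inv = 𝟙 A' := by
    have h₁ : φ.hom ≫ (∑ k, biproduct.π Y k ≫ biproduct.ι Y k) ≫ φ.inv = 𝟙 A' := by simp
    rw [← h₁, Preadditive.sum_comp, Preadditive.comp_sum]
    simp
  have h₂ : ∀ k, (S.homSusp T).map (f k ≫ biproduct.ι Y k ≫ φ.inv).op =
      (S.homSusp T).map ((φ.hom ≫ biproduct.π Y k) ≫ biproduct.ι Y k ≫ φ.inv).op ≫ η := by
    intro k
    rw [op_comp, Functor.map_comp, hf, ← Category.assoc, ← Functor.map_comp, ← op_comp]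
  rw [op_sum, Functor.map_sum, Finset.sum_congr rfl fun k _ => h₂ k, ← Preadditive.sum_comp,
    ← Functor.map_sum, ← op_sum, key, op_id, CategoryTheory.Functor.map_id, Category.id_comp]

/-- Condition (b) implies fullness. -/
lemma fullAt_of_conditionB (hKS : IsKrullSchmidt C) (hE : S.ExtVanishing T)
    (hB : S.ConditionB T) (A' : C) : S.FullAt T A' := by
  obtain ⟨n, Y, hY, ⟨φ⟩⟩ := hKS A'
  refine FullAt.of_iso_biproduct φ fun k => ?_
  have := hY k
  by_cases h0 : IsZero (S.homSuspObj T (Y k))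
  · exact .of_isZero h0
  · exact HasPresentingDiagram.fullAt hE (hB (Y k) indecomposable_of_isLocalRing_end h0)

/-- Fullness and density imply condition (a). -/
lemma conditionA_of_full_of_dense (hE : S.ExtVanishing T) (hfull : ∀ A', S.FullAt T A')
    (hdense : ∀ F, finPres (S.SuspBar T) F → ∃ A, Nonempty (S.homSuspObj T A ≅ F)) :
    S.ConditionA T := by
  intro T₂ T₁ A I S₂ S₁ a h b c i j r g hd hT₁ hT₂ hI _ hmin
  have hS₂ : S.susp T S₂ := hd.susp_left hT₂ hI
  have hS₁ : S.susp T S₁ := hd.susp_right hT₁ hI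
  -- Density gives X with universal element ρ, the weak kernel r gives f, and fullness gives p from
  -- the transformation that sends ρ to r.
  obtain ⟨X, ρ, f, p, hρ, hf, hp⟩ : ∃ (X : C) (ρ : X ⟶ S₂) (f : X ⟶ A) (p : A ⟶ X),
      Presents (S.homSuspObj T X) (suspHom (hY := hS₂) (hY' := hS₁) g) (S.bar.map ρ) ∧
      S.bar.map (f ≫ r) = S.bar.map ρ ∧ S.bar.map (p ≫ ρ) = S.bar.map r := by
    obtain ⟨q, hq⟩ := Presents.cokernel (suspHom (hY := hS₂) (hY' := hS₁) g)
    obtain ⟨X, ⟨e⟩⟩ := hdense _ (finPres_iff.2 ⟨_, _, _, _, hq⟩)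
    have hX := hq.of_iso e.symm
    obtain ⟨ρ, hρ⟩ := S.bar.map_surjective (X := X) (Y := S₂) ((e.symm.hom.app _).hom q)
    rw [← hρ] at hX
    obtain ⟨f, hf⟩ := hd.exists_lift hE hT₁ ρ (by
      rw [← bar_map_eq_zero_iff, S.bar.map_comp]
      exact hX.map_eq_zero)
    obtain ⟨η, hη⟩ := hX.exists_hom (homSuspObj_map_add A) (S.bar.map r) (by
      refine (S.bar.map_comp r g).symm.trans ?_
      rw [hd.comp_zero, S.bar.map_zero]
      rfl)
    obtain ⟨p, rfl⟩ := hfull X A η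
    exact ⟨X, ρ, f, p, hX, hf, (S.bar.map_comp p ρ).trans hη⟩
  obtain ⟨hρ, -⟩ := (presents_homSuspObj_iff ρ g).1 hρ
  obtain ⟨-, hc, -, δ₁, δ₂, ε₁, ε₂, -, -, h₁, h', -, hε⟩ := hd
  have hs : S.IsSusp T i j ε₁ := ⟨hT₁, hI, h₁⟩
  have her : S.bar.map r = S.bar.map ((p ≫ f) ≫ r) := by
    rw [← hp, Category.assoc, S.bar.map_comp, ← hf, S.bar.map_comp p]
  -- The maps r and `(p ≫ f) ≫ r` agree only modulo injectives. Extending u along r and correcting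
  -- the identity of S₂ by it makes the square commute, so (ET3) gives α.
  obtain ⟨J, u, v, hJ, huv⟩ := bar_map_eq_iff.1 her
  obtain ⟨u', rfl⟩ := hJ r g ε₂ h' u
  obtain ⟨α, hα, hα'⟩ := S.et3 h' h' (p ≫ f) (𝟙 S₂ - u' ≫ v)
    (by rw [Preadditive.comp_sub, ← Category.assoc, huv]; simp)
  have hgα : S.bar.map g ≫ S.bar.map α = S.bar.map g := by
    rw [← S.bar.map_comp, hα, bar_map_eq_iff]
    simpa using FactorsInj.neg ⟨J, u', v ≫ g, hJ, rfl⟩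
  have := hmin _ hgα
  obtain ⟨α', hα''⟩ := S.bar.map_surjective (inv (S.bar.map α))
  -- β and β' are the counterparts on T₁ of α and its inverse: modulo injectives, `h ≫ p ≫ f` equals
  -- `β ≫ h`, and β' cancels β.
  obtain ⟨β, hβ⟩ := hs.exists_push hE hT₁ (pull α ε₁)
  obtain ⟨β', hβ'⟩ := hs.exists_push hE hT₁ (pull α' ε₁)
  have h₂ : S.FactorsInj (h ≫ p ≫ f - β ≫ h) := by
    apply hs.push_eq_zero
    rw [push_sub, push_comp, hε, hα', ← hε, ← push_pull, ← hβ, ← push_comp, sub_self]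
  have h₃ : S.FactorsInj (𝟙 T₁ - β' ≫ β) := by
    apply hs.push_eq_zero
    rw [push_sub, push_comp, hβ', push_pull, hβ, ← pull_comp, push_id,
      ← pull_id (δ := ε₁), ← pull_comp, sub_eq_zero, hs.pull_eq_iff hE]
    simp [hα'']
  rw [homSusp_map_eq_zero_iff]
  intro Y hY y
  obtain ⟨x, hx⟩ := hρ Y hY (f ≫ y)
  -- Write `f ≫ y` as `ρ ≫ x`; the composite becomes `h ≫ r ≫ x` = `i ≫ c ≫ x`, which passes through
  -- I.
  have h₄ : S.bar.map (h ≫ p ≫ f ≫ y) = 0 := by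
    rw [S.bar.map_comp, S.bar.map_comp p, ← hx, ← S.bar.map_comp, ← Category.assoc,
      S.bar.map_comp (p ≫ ρ), hp, ← S.bar.map_comp r, ← S.bar.map_comp, bar_map_eq_zero_iff,
      reassoc_of% hc]
    exact ⟨I, i, c ≫ x, hI, rfl⟩
  rw [← bar_map_eq_zero_iff] at h₂ h₃ ⊢
  rw [S.bar.map_sub, sub_eq_zero] at h₂ h₃
  calc S.bar.map (h ≫ y) = S.bar.map (𝟙 T₁) ≫ S.bar.map h ≫ S.bar.map y := by simp
    _ = S.bar.map β' ≫ S.bar.map (β ≫ h) ≫ S.bar.map y := by rw [h₃]; simp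
    _ = S.bar.map β' ≫ S.bar.map (h ≫ p ≫ f ≫ y) := by rw [← h₂]; simp
    _ = 0 := by rw [h₄, Limits.comp_zero]

end ExtriangulatedStructure

end Extriang

/-! ### Left minimal presentations, density and condition (b) -/

namespace Extriang

lemma IsLeftMinimal.of_arrow_iso {D : Type*} [Category* D] {X Y X' Y' : D} {g : X ⟶ Y}
    {g' : X' ⟶ Y'} (hg : IsLeftMinimal g) (l : X ≅ X') (σ : Y ≅ Y')
    (h : l.hom ≫ g' = g ≫ σ.hom) : IsLeftMinimal g' := by
  intro α hα
  have := hg (σ.hom ≫ α ≫ σ.inv) (by rw [← reassoc_of% h, reassoc_of% hα, reassoc_of% h]; simp)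
  have : α = σ.inv ≫ (σ.hom ≫ α ≫ σ.inv) ≫ σ.hom := by simp
  rw [this]
  infer_instance

namespace ExtriangulatedStructure

variable {C : Type u} [Category.{v} C] [Preadditive C] [HasFiniteBiproducts C]
variable {S : ExtriangulatedStructure.{w} C} {T : ObjectProperty C}

lemma IsSusp.exists_iso {X I Y X' I' Y' : C} {x : X ⟶ I} {y : I ⟶ Y} {δ : Ext S.E Y X}
    {x' : X' ⟶ I'} {y' : I' ⟶ Y'} {δ' : Ext S.E Y' X'} (h : S.IsSusp T x y δ)
    (h' : S.IsSusp T x' y' δ') (hE : S.ExtVanishing T) (f : X ⟶ X') (f' : X' ⟶ X)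
    (h₁ : push f' (push f δ) = δ) (h₂ : push f (push f' δ') = δ') :
    ∃ (s : Y ⟶ Y') (σ : S.bar.obj Y ≅ S.bar.obj Y'), σ.hom = S.bar.map s ∧
      pull s δ' = push f δ := by
  obtain ⟨s, hs⟩ := h'.exists_pull (push f δ)
  obtain ⟨s', hs'⟩ := h.exists_pull (push f' δ')
  refine ⟨s, ⟨S.bar.map s, S.bar.map s', ?_, ?_⟩, rfl, hs⟩
  · rw [← S.bar.map_comp, ← S.bar.map_id, ← h.pull_eq_iff hE, pull_comp, hs', ← push_pull, hs, h₁,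
      pull_id]
  · rw [← S.bar.map_comp, ← S.bar.map_id, ← h'.pull_eq_iff hE, pull_comp, hs, ← push_pull, hs', h₂,
      pull_id]

/-- α corresponds to an endomorphism β of T₁ fixing g^*ε. Hence the Fitting idempotent of β fixes it
too, and g factors through Σ of the image of that idempotent, a proper summand as α is not
invertible. -/
lemma exists_smaller_presentation {k : Type*} [Field k] [Linear k C] (hfin : IsHomFinite k C)
    (hKS : IsKrullSchmidt C) (hinj : S.EnoughInjectives) (hT : IsAdditiveSubcategory T)
    (hE : S.ExtVanishing T) {F : S.SuspBar T ⥤ AddCommGrpCat.{v}} {S₂ : C} {hS₂ : S.susp T S₂}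
    {p : F.obj (S.suspObj T S₂ hS₂)} {T₁ I₁ S₁ : C} {i : T₁ ⟶ I₁} {j : I₁ ⟶ S₁}
    {ε : Ext S.E S₁ T₁} (h : S.IsSusp T i j ε) {g : S₂ ⟶ S₁}
    (hF : Presents F (suspHom (hY' := h.susp) g) p) {α : S₁ ⟶ S₁}
    (hα : S.bar.map g ≫ S.bar.map α = S.bar.map g) (hα' : ¬ IsIso (S.bar.map α)) :
    ∃ (X J S' : C) (x : X ⟶ J) (y : J ⟶ S') (δ : Ext S.E S' X) (h' : S.IsSusp T x y δ)
      (g' : S₂ ⟶ S'), Presents F (suspHom (hY' := h'.susp) g') p ∧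
        Module.finrank k (X ⟶ X) < Module.finrank k (T₁ ⟶ T₁) := by
  obtain ⟨β, hβ⟩ := h.exists_push hE h.mem (pull α ε)
  have : Module.Finite k (End T₁) := hfin T₁ T₁
  let B : ℕ → (T₁ ⟶ T₁) := fun n => HPow.hPow (α := End T₁) β n
  -- Multiplication in `End T₁` is composition in the reverse order.
  obtain ⟨e, y, m, he, hy, hy', hm⟩ : ∃ (e y : T₁ ⟶ T₁) (m : ℕ), e ≫ e = e ∧ y ≫ β = e ∧
      β ≫ y = e ∧ B m ≫ (𝟙 T₁ - e) = 0 :=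
    exists_fitting_idempotent (k := k) (R := End T₁) β
  have hθ : push β (pull g ε) = pull g ε := by
    rw [push_pull, hβ, ← pull_comp, h.pull_eq_iff hE, S.bar.map_comp, hα]
  have hθm : ∀ n : ℕ, push (B n) (pull g ε) = pull g ε := by
    intro n
    induction n with
    | zero => exact push_id (pull g ε)
    | succ n ih =>
      have hB : B (n + 1) = β ≫ B n := pow_succ (M := End T₁) β n
      rw [hB, push_comp]
      rw [hθ, ih]
  have hθe : push e (pull g ε) = pull g ε := by
    have h₁ : push (𝟙 T₁ - e) (pull g ε) = 0 := by
      rw [← hθm m, ← push_comp, hm, push_zero]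
    rwa [push_sub, push_id, sub_eq_zero, eq_comm] at h₁
  obtain ⟨X, ι, π, hιπ, hπι⟩ := hKS.splits e he
  have hX : T X := by
    obtain ⟨Z, φ, -⟩ := hKS.exists_iso_biprod ι π hιπ
    exact hT.summand (hT.iso φ h.mem)
  obtain ⟨J, S', x, y', δ, h'⟩ := hinj.exists_isSusp hX
  obtain ⟨σ, hσ⟩ := h'.exists_pull (push π ε)
  obtain ⟨τ, hτ⟩ := h.exists_pull (push ι δ)
  have hg : S.bar.map ((g ≫ σ) ≫ τ) = S.bar.map g := by
    rw [← h.pull_eq_iff hE, pull_comp, hτ, pull_comp, ← push_pull, hσ, ← push_pull, ← push_pull,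
      ← push_comp, hπι, hθe]
  have hF' := hF.of_factor (suspHom (hY' := h'.susp) σ) (suspHom τ)
    (InducedCategory.hom_ext (by simpa using hg))
  refine ⟨X, J, S', x, y', δ, h', g ≫ σ, ?_, ?_⟩
  · convert hF' using 1
    exact InducedCategory.hom_ext (S.bar.map_comp g σ)
  · let Φ : (X ⟶ X) →ₗ[k] (T₁ ⟶ T₁) :=
      { toFun := fun f => π ≫ f ≫ ι
        map_add' := by simp
        map_smul' := by simp }
    have := hfin X X
    have := hfin T₁ T₁
    have hΦ : Function.Injective Φ := by
      intro f f' hf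
      have := ι ≫= hf =≫ π
      simpa [Φ, hιπ, reassoc_of% hιπ] using this
    -- Equal dimensions would put 𝟙 in the image of Φ, so e = 𝟙; then β, and with it α, would be
    -- invertible.
    refine (LinearMap.finrank_le_finrank_of_injective hΦ).lt_of_ne fun heq => hα' ?_
    obtain ⟨f, hf⟩ := (LinearMap.injective_iff_surjective_of_finrank_eq_finrank heq).1 hΦ (𝟙 T₁)
    replace hf : π ≫ f ≫ ι = 𝟙 T₁ := hf
    have he1 : e = 𝟙 T₁ := by
      rw [← Category.comp_id e, ← hf, ← hπι, Category.assoc, reassoc_of% hιπ]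
    obtain ⟨s, σ', hs, hs'⟩ := h.exists_iso h hE β y
      (by rw [← push_comp, hy', he1, push_id]) (by rw [← push_comp, hy, he1, push_id])
    rw [hβ, h.pull_eq_iff hE] at hs'
    rw [← hs', ← hs]
    infer_instance

/-- Every presentation of a functor can be replaced by one by a left minimal morphism. -/
lemma exists_leftMinimal_presentation {k : Type*} [Field k] [Linear k C] (hfin : IsHomFinite k C)
    (hKS : IsKrullSchmidt C) (hinj : S.EnoughInjectives) (hT : IsAdditiveSubcategory T)
    (hE : S.ExtVanishing T) {F : S.SuspBar T ⥤ AddCommGrpCat.{v}} {S₂ : C} {hS₂ : S.susp T S₂}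
    {p : F.obj (S.suspObj T S₂ hS₂)} {T₁ I₁ S₁ : C} {i : T₁ ⟶ I₁} {j : I₁ ⟶ S₁}
    {ε : Ext S.E S₁ T₁} (h : S.IsSusp T i j ε) {g : S₂ ⟶ S₁}
    (hF : Presents F (suspHom (hY' := h.susp) g) p) :
    ∃ (S' : C) (hS' : S.susp T S') (g' : S₂ ⟶ S'), Presents F (suspHom (hY' := hS') g') p ∧
      IsLeftMinimal (S.bar.map g') := by
  induction hn : Module.finrank k (T₁ ⟶ T₁) using Nat.strong_induction_on
    generalizing T₁ I₁ S₁ i j ε g with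
  | _ n ih =>
    by_cases hmin : IsLeftMinimal (S.bar.map g)
    · exact ⟨S₁, h.susp, g, hF, hmin⟩
    · simp only [IsLeftMinimal, not_forall] at hmin
      obtain ⟨α, hα, hα'⟩ := hmin
      obtain ⟨α, rfl⟩ := S.bar.map_surjective α
      obtain ⟨X, J, S', x, y, δ, h', g', hF', hlt⟩ :=
        exists_smaller_presentation hfin hKS hinj hT hE h hF hα hα'
      exact ih _ (hn ▸ hlt) h' hF' rfl

/-- Every morphism of `Σ T / I` occurs in a diagram, up to isomorphism. -/
lemma exists_isDiagram_of_hom (hinj : S.EnoughInjectives) (hT : IsAdditiveSubcategory T)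
    (hIT : ∀ I : C, S.injectives I → T I) (hE : S.ExtVanishing T) {S₂ S₁ : C}
    (hS₂ : S.susp T S₂) (hS₁ : S.susp T S₁) (g : S₂ ⟶ S₁) :
    ∃ (T₂ T₁ A I S₂' S₁' : C) (a : T₂ ⟶ T₁) (h : T₁ ⟶ A) (b : T₂ ⟶ I) (c : I ⟶ S₂')
      (i : T₁ ⟶ I) (j : I ⟶ S₁') (r : A ⟶ S₂') (g' : S₂' ⟶ S₁')
      (l : S.bar.obj S₂ ≅ S.bar.obj S₂') (σ : S.bar.obj S₁ ≅ S.bar.obj S₁'),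
      S.IsDiagram a h b c i j r g' ∧ T T₁ ∧ T T₂ ∧ S.injectives I ∧
        l.hom ≫ S.bar.map g' = S.bar.map g ≫ σ.hom := by
  obtain ⟨T₂, I₂, i₂, j₂, δ₂, h₂⟩ := susp_iff.1 hS₂
  obtain ⟨T₁, I₁, i₁, j₁, ε, h₁⟩ := susp_iff.1 hS₁
  obtain ⟨t, ht⟩ := h₂.exists_push hE h₁.mem (pull g ε)
  -- The map t representing g need not be an inflation; adding the component i₂ into I₂ makes it one
  -- and changes nothing modulo injectives.
  obtain ⟨A, h, θ, hθ⟩ := h₂.tri.exists_isTriangle_lift t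
  have hT₁ : T (T₁ ⊞ I₂) := hT.sum h₁.mem (hIT _ h₂.inj)
  obtain ⟨I, S₁', i, j, ε', h₁'⟩ := hinj.exists_isSusp hT₁
  obtain ⟨S₂', c, r, g', δ₂', hd, hδ₂', hg'⟩ := hθ.exists_isDiagram h₁'.tri
  have h₂' : S.IsSusp T _ c δ₂' := ⟨h₂.mem, h₁'.inj, hδ₂'⟩
  obtain ⟨s, l, hl, hs⟩ := h₂.exists_iso h₂' hE (𝟙 _) (𝟙 _) (by simp) (by simp)
  obtain ⟨s₁, σ, hσ, hs₁⟩ := h₁.exists_iso h₁' hE (biprod.inl : T₁ ⟶ T₁ ⊞ I₂) biprod.fst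
    (by rw [← push_comp, biprod.inl_fst, push_id]) (by
      have h₃ : S.FactorsInj (𝟙 (T₁ ⊞ I₂) - biprod.fst ≫ biprod.inl) :=
        ⟨I₂, biprod.snd, biprod.inr, h₂.inj, by rw [← biprod.total, add_sub_cancel_left]⟩
      have h₄ := h₃.push_eq_zero ε'
      rwa [push_sub, push_id, push_comp, sub_eq_zero, eq_comm] at h₄)
  refine ⟨T₂, T₁ ⊞ I₂, A, I, S₂', S₁', _, h, _, c, i, j, r, g', l, σ, hd, hT₁, h₂.mem, h₁'.inj, ?_⟩
  rw [hl, hσ, ← S.bar.map_comp, ← S.bar.map_comp, ← h₁'.pull_eq_iff hE, pull_comp, ← hg',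
    ← push_pull, hs, push_id, pull_comp, hs₁, ← push_pull, ← ht, ← push_comp, ← sub_eq_zero,
    ← push_sub]
  refine FactorsInj.push_eq_zero ⟨I₂, i₂, biprod.inr, h₂.inj, ?_⟩ _
  ext <;> simp

open ZeroObject in
/-- Under condition (a), every finitely presented functor is represented by an object with a
presenting diagram. -/
lemma exists_hasPresentingDiagram_iso {k : Type*} [Field k] [Linear k C] (hfin : IsHomFinite k C)
    (hKS : IsKrullSchmidt C) (hinj : S.EnoughInjectives) (hT : IsAdditiveSubcategory T)
    (hIT : ∀ I : C, S.injectives I → T I) (hE : S.ExtVanishing T) (hA : S.ConditionA T)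
    {F : S.SuspBar T ⥤ AddCommGrpCat.{v}} (hF : finPres (S.SuspBar T) F) :
    ∃ A, S.HasPresentingDiagram T A ∧ Nonempty (S.homSuspObj T A ≅ F) := by
  obtain ⟨Y₂, Y₁, g, p, hp⟩ := finPres_iff.1 hF
  obtain ⟨g, rfl⟩ := suspHom_surjective g
  obtain ⟨T₁, I₁, i₁, j₁, ε, h₁⟩ := susp_iff.1 Y₁.property
  obtain ⟨S₁, hS₁, g, hp, hmin⟩ := exists_leftMinimal_presentation hfin hKS hinj hT hE h₁ hp
  have hS₂ := Y₂.property
  -- Condition (a) excludes zero g. In that case the functor is Hom(S₂, -), and S₂ has the diagram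
  -- with T₁ = I = I₂ and S₁ = 0, where h starts at an injective.
  by_cases hg : S.bar.map g = 0
  · obtain ⟨T₂, I₂, i₂, j₂, δ₂, h₂⟩ := susp_iff.1 hS₂
    have hO := isZero_zero C
    have hd : S.IsDiagram i₂ j₂ i₂ j₂ (𝟙 I₂) (0 : I₂ ⟶ 0) (𝟙 Y₂.obj.as) 0 :=
      ⟨by simp, by simp, by simp, δ₂, δ₂, 0, 0, h₂.tri, h₂.tri, isTriangle_id_zero _ hO,
        isTriangle_id_zero _ hO, by simp, by simp⟩
    have hh : (S.homSusp T).map j₂.op = 0 :=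
      homSusp_map_eq_zero_iff _ |>.2 fun Y _ y => ⟨I₂, 𝟙 _, j₂ ≫ y, h₂.inj, by simp⟩
    have hS₀ : S.susp T (0 : C) := hd.susp_right (hIT _ h₂.inj) h₂.inj
    refine ⟨Y₂.obj.as, ⟨T₂, I₂, I₂, _, _, _, _, _, _, _, _, _, _, hd, hIT _ h₂.inj, h₂.mem, h₂.inj,
      hh⟩, ?_⟩
    have hp' := hp.of_factor (suspHom (hY' := hS₀) 0) (suspHom 0)
      (InducedCategory.hom_ext (by simp [hg]))
    refine (hd.presents hE hS₂ hS₀ hh).nonempty_iso (p' := p) ?_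
    convert hp' using 1
    exact InducedCategory.hom_ext (by simp)
  · obtain ⟨T₂, T₁', A, I, S₂', S₁', a, h, b, c, i, j, r, g', l, σ, hd, hT₁, hT₂, hI, hlg⟩ :=
      exists_isDiagram_of_hom hinj hT hIT hE hS₂ hS₁ g
    have hh := hA a h b c i j r g' hd hT₁ hT₂ hI
      (fun h0 => hg (by
        rw [h0, Limits.comp_zero] at hlg
        rw [← cancel_mono σ.hom, ← hlg, Limits.zero_comp])) (hmin.of_arrow_iso l σ hlg)
    refine ⟨A, ⟨_, _, _, _, _, _, _, _, _, _, _, _, _, hd, hT₁, hT₂, hI, hh⟩, ?_⟩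
    have hS₂' := hd.susp_left hT₂ hI
    have hS₁' := hd.susp_right hT₁ hI
    exact (hd.presents hE hS₂' hS₁' hh).nonempty_iso
      (hp.of_arrow_iso (S₂' := S.suspObj T S₂' hS₂') (S₁' := S.suspObj T S₁' hS₁')
        (ObjectProperty.isoMk _ l) (ObjectProperty.isoMk _ σ)
        (InducedCategory.hom_ext hlg))

/-- A summand on whose complement `Hom(-, Σ T)` vanishes inherits a presenting diagram. -/
lemma HasPresentingDiagram.of_iso_biprod (hinj : S.EnoughInjectives)
    (hT : IsAdditiveSubcategory T) (hE : S.ExtVanishing T) {A' A Z : C}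
    (hA' : S.HasPresentingDiagram T A') (φ : A' ≅ A ⊞ Z)
    (hZ : ∀ Y, S.susp T Y → ∀ y : Z ⟶ Y, S.FactorsInj y) : S.HasPresentingDiagram T A := by
  obtain ⟨T₂, T₁, I, S₂, S₁, a, h, b, c, i, j, r, g, hd, hT₁, hT₂, hI, hh⟩ := hA'
  obtain ⟨-, -, -, δ₁, δ₂, ε₁, ε₂, h₀, -⟩ := hd
  have hZ₀ : ∀ (X : C), T X → ∀ θ : Ext S.E Z X, θ = 0 := by
    intro X hX θ
    obtain ⟨J, Y, x, y, δ, hδ⟩ := hinj.exists_isSusp hX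
    obtain ⟨f, rfl⟩ := hδ.exists_pull θ
    exact (hδ.pull_eq_zero_iff hE f).2 (hZ Y hδ.susp f)
  have hφ : S.IsTriangle (biprod.inl ≫ φ.inv) (φ.hom ≫ biprod.snd) (0 : Ext S.E Z A) :=
    (isTriangle_split Z A).of_iso φ.symm (by simp) (by simp)
  -- Restrict the top row to A: this gives T₂ → G → A and G → T₁ → Z. Since E(Z, T₂) = 0, the
  -- inclusion of Z lifts to T₁, so the second triangle splits and G is a summand of T₁.
  obtain ⟨G, e, d, h', δ'', h₁, h₂, -, h₃, -⟩ := S.et4_op hφ h₀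
  obtain ⟨q, hq⟩ := (h₀.pull_eq_zero_iff (biprod.inr ≫ φ.inv)).1 (hZ₀ _ hT₂ _)
  have hδ'' : δ'' = 0 := by
    have := (IsTriangle.pull_eq_zero_iff (S := S) h₁ (𝟙 Z)).2 ⟨q, by simp [reassoc_of% hq]⟩
    simpa using this
  subst hδ''
  obtain ⟨ψ, -⟩ := seqClass_eq_iff.1 ((S.s_zero Z G).symm.trans h₁)
  have hG : T G := hT.summand (hT.iso ψ.symm hT₁)
  obtain ⟨J, S', x, y, δ, hδ⟩ := hinj.exists_isSusp hG
  obtain ⟨S'', c', r', g', -, hd', -⟩ :=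
    IsTriangle.exists_isDiagram (S := S) h₃ hδ.tri
  refine ⟨_, _, _, _, _, _, _, _, _, _, _, _, _, hd', hG, hT₂, hδ.inj, ?_⟩
  rw [homSusp_map_eq_zero_iff] at hh ⊢
  intro Y hY y
  have := (hh Y hY (φ.hom ≫ biprod.fst ≫ y)).comp_left h'
  rw [← reassoc_of% h₂] at this
  simpa using this

/-- Fullness and condition (a) imply condition (b). -/
lemma conditionB_of_full_of_conditionA {k : Type*} [Field k] [Linear k C] (hfin : IsHomFinite k C)
    (hKS : IsKrullSchmidt C) (hproj : S.EnoughProjectives) (hinj : S.EnoughInjectives)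
    (hcov : CovariantlyFinite T) (hT : IsAdditiveSubcategory T)
    (hIT : ∀ I : C, S.injectives I → T I) (hE : S.ExtVanishing T) (hfull : ∀ A', S.FullAt T A')
    (hA : S.ConditionA T) : S.ConditionB T := by
  intro A hAi hA0
  obtain ⟨A', hA', ⟨e⟩⟩ := exists_hasPresentingDiagram_iso hfin hKS hinj hT hIT hE hA
    (finPres_homSuspObj hproj hinj hcov hE A)
  obtain ⟨f, hf⟩ := hfull A' A e.hom
  obtain ⟨p, hp⟩ := hfull A A' e.inv
  have hfp : (S.homSusp T).map (f ≫ p).op = 𝟙 _ := by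
    rw [op_comp, Functor.map_comp, hf, hp, e.inv_hom_id]
  have : IsIso (f ≫ p) := by
    -- 𝟙 - `f ≫ p` acts as zero on the nonzero functor Hom(A, -), so it is not invertible.
    refine (hKS.isIso_or_isIso_one_sub hAi (f ≫ p)).resolve_right fun hiso => hA0 ?_
    have h₁ : (S.homSusp T).map (𝟙 A - f ≫ p).op = 0 := by
      rw [op_sub, Functor.map_sub, hfp, op_id, CategoryTheory.Functor.map_id, sub_self]
    rw [IsZero.iff_id_eq_zero, ← cancel_epi ((S.homSusp T).map (𝟙 A - f ≫ p).op), h₁]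
    simp
  obtain ⟨Z, φ, -, hφ⟩ := hKS.exists_iso_biprod f (p ≫ inv (f ≫ p))
    (by rw [← Category.assoc, IsIso.hom_inv_id])
  refine hA'.of_iso_biprod hinj hT hE φ fun Y hY y => ?_
  -- f followed by the projection to Z is zero, while f induces an isomorphism of functors; so the
  -- projection acts as zero.
  have h₁ : (S.homSusp T).map (φ.hom ≫ biprod.snd).op = 0 := by
    have h₂ : (f ≫ φ.hom ≫ biprod.snd : A ⟶ Z) = 0 := by simp [← hφ]
    rw [← cancel_mono e.hom, ← hf, ← Functor.map_comp, ← op_comp, h₂]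
    simp
  have h₂ := (homSusp_map_eq_zero_iff _ |>.1 h₁ Y hY y).comp_left (biprod.inr ≫ φ.inv)
  simpa using h₂

end ExtriangulatedStructure

end Extriang

theorem mainTheorem3 {k : Type*} [Field k] {B : Type u} [Category.{v} B] [Preadditive B]
    [Linear k B] [HasFiniteBiproducts B]
    (hfin : Extriang.IsHomFinite k B) (hKS : Extriang.IsKrullSchmidt B)
    (S : Extriang.ExtriangulatedStructure.{w} B)
    (hproj : S.EnoughProjectives) (hinj : S.EnoughInjectives)
    (T : ObjectProperty B) (hT : Extriang.IsAdditiveSubcategory T)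
    (hcov : Extriang.CovariantlyFinite T)
    (hIT : ∀ I : B, S.injectives I → T I)
    (hE : ∀ I X : B, S.injectives I → T X → ∀ δ : Extriang.Ext S.E I X, δ = 0) :
    ∃ hfp : ∀ A : Bᵒᵖ, Extriang.finPres (S.SuspBar T) ((S.homSusp T).obj A),
      (((Extriang.finPres (S.SuspBar T)).lift (S.homSusp T) hfp).Full ∧
        ((Extriang.finPres (S.SuspBar T)).lift (S.homSusp T) hfp).EssSurj) ↔
      (S.ConditionA T ∧ S.ConditionB T) := by
  refine ⟨fun A => Extriang.ExtriangulatedStructure.finPres_homSuspObj hproj hinj hcov hE A.unop,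
    ?_⟩
  constructor
  · rintro ⟨h₁, h₂⟩
    have hfull : ∀ A', S.FullAt T A' := fun A' A η => by
      obtain ⟨f, hf⟩ := h₁.map_surjective (X := op A') (Y := op A) (ObjectProperty.homMk η)
      exact ⟨f.unop, congrArg (fun g => g.hom) hf⟩
    have hA : S.ConditionA T := Extriang.ExtriangulatedStructure.conditionA_of_full_of_dense hE
      hfull fun F hF => by
        obtain ⟨A, ⟨e⟩⟩ := h₂.mem_essImage ⟨F, hF⟩
        exact ⟨A.unop, ⟨(ObjectProperty.ι _).mapIso e⟩⟩
    exact ⟨hA, Extriang.ExtriangulatedStructure.conditionB_of_full_of_conditionA hfin hKS hproj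
      hinj hcov hT hIT hE hfull hA⟩
  · rintro ⟨hA, hB⟩
    refine ⟨⟨fun {A' A} η => ?_⟩, ⟨fun F => ?_⟩⟩
    · obtain ⟨f, hf⟩ := Extriang.ExtriangulatedStructure.fullAt_of_conditionB hKS hE hB A'.unop
        A.unop η.hom
      exact ⟨f.op, InducedCategory.hom_ext hf⟩
    · obtain ⟨A, -, ⟨e⟩⟩ := Extriang.ExtriangulatedStructure.exists_hasPresentingDiagram_iso hfin
        hKS hinj hT hIT hE hA F.property
      exact ⟨op A, ⟨ObjectProperty.isoMk _ e⟩⟩
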